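/- Identify $\Lambda=\mathbb{R}^3$ with the pure quaternions $z=x_1\mathbf i+x_2\mathbf j+x_3\mathbf k$, and let $d\mu(z)=f(z)\,dm(z)$, where $m$ is Lebesgue measure on $\mathbb{R}^3$ and $f(z)=(2\pi)^{-3/2}e^{-|z|^2/2}$. On quaternionic polynomial functions $\sum_k z^k a_k$ ($a_k\in\mathbb{H}$) of $z\in\Lambda$ consider the scalar product $\langle u,w\rangle=\int_\Lambda \overline{u(z)}\,w(z)\,d\mu(z)$. Let $(P_k)_{k\ge 0}$ be the monic orthogonal polynomials for it (obtained from $1,z,z^2,\dots$ by the Gram--Schmidt process), let $h_k=\langle P_k,P_k\rangle$, and $$K_n(z,w)=\sum_{k=0}^{n-1}\frac{P_k(z)\overline{P_k(w)}}{h_k}.$$ A simple random point field on $\Lambda$ is determinantal with kernel $K_n$ if, for every $k$, its $k$-point correlation function with respect to $\mu$ is the Dyson--Moore determinant of the matrix $(K_n(x_i,x_j))_{1\le i,j\le k}$. Put $\rho_n(x)=K_n(x,x)f(x)$. This is a continuous function, and it is the density, with respect to Lebesgue measure, of every determinantal field with kernel $K_n$: the expected number of points in a measurable set $A$ is $\int_A\rho_n\,dm$.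 Let $$\mathfrak{p}_n(r)=\int_{rS^2}\rho_n(x)\,d\sigma_r(x)$$ be the radial density, where $\sigma_r$ is the surface measure on the sphere $rS^2$ of radius $r$. Then for every real $s>0$ $$\lim_{n\to\infty}\frac{1}{2\sqrt n}\,\mathfrak{p}_n\big(2\sqrt n\,s\big)=\begin{cases}\frac1\pi\sqrt{1-s^2},& s<1,\\ 0,& s>1.\end{cases}$$ -/

import Mathlib

open MeasureTheory Filter Topology

open scoped Quaternion

noncomputable section

namespace QuaternionField

/-- The space `Λ = ℝ³` with its Euclidean norm and Lebesgue measure. -/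
abbrev Space : Type := EuclideanSpace ℝ (Fin 3)

/-- The identification of `(x₁, x₂, x₃)` with the pure quaternion `x₁ i + x₂ j + x₃ k`. -/
def toPure (x : Space) : ℍ[ℝ] := ⟨0, x 0, x 1, x 2⟩

/-- The standard Gaussian density on `ℝ³`. -/
def gaussDensity (x : Space) : ℝ :=
  (2 * Real.pi) ^ (-(3 / 2) : ℝ) * Real.exp (-‖x‖ ^ 2 / 2)

/-- The background measure: the standard Gaussian measure on `ℝ³`. -/
def background : Measure Space :=
  volume.withDensity (fun x => ENNReal.ofReal (gaussDensity x))

/-- The quaternion-valued scalar product `⟨u, w⟩ = ∫ ū w dμ`, linear on the right in `w`. -/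
def scalarProduct (u w : Space → ℍ[ℝ]) : ℍ[ℝ] :=
  ∫ z, star (u z) * w z ∂background

/-- The squared norm `⟨u, u⟩` (a non-negative real number). -/
def normSquare (u : Space → ℍ[ℝ]) : ℝ := (scalarProduct u u).re

/-- The monic orthogonal polynomials, obtained from the monomials `z ^ k` by the Gram-Schmidt
process in the right `ℍ`-module of quaternionic polynomials in a pure quaternion variable:
`P_k = z ^ k - ∑_{j < k} P_j ⟨P_j, P_j⟩⁻¹ ⟨P_j, z ^ k⟩`. -/
def orthoPoly (k : ℕ) : Space → ℍ[ℝ] := fun z =>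
  toPure z ^ k - ∑ j : Fin k,
    orthoPoly j z * ((normSquare (orthoPoly j))⁻¹ •
      scalarProduct (orthoPoly j) (fun w => toPure w ^ k))
termination_by k
decreasing_by all_goals exact j.2

/-- The kernel `K_n(z, w) = ∑_{k < n} P_k(z) conj(P_k(w)) / h_k` with `h_k = ⟨P_k, P_k⟩`. -/
def kernel (n : ℕ) (z w : Space) : ℍ[ℝ] :=
  ∑ k ∈ Finset.range n,
    (normSquare (orthoPoly k))⁻¹ • (orthoPoly k z * star (orthoPoly k w))

/-- The ordered product `a_{i σ(i)} a_{σ(i) σ²(i)} ⋯` along the cycle of `σ` that starts at `i`. -/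
def cycleProduct {k : ℕ} (a : Fin k → Fin k → ℍ[ℝ]) (σ : Equiv.Perm (Fin k)) (i : Fin k) : ℍ[ℝ] :=
  ((List.range (Function.minimalPeriod σ i)).map
    (fun j => a ((σ ^ j) i) ((σ ^ (j + 1)) i))).prod

open Classical in
/-- The Dyson-Moore determinant of a self-dual quaternion matrix: the signed sum over all
permutations of the product, over the cycles (one representative each, the smallest element),
of the scalar part of the ordered product along the cycle. -/
def dysonMooreDet {k : ℕ} (a : Fin k → Fin k → ℍ[ℝ]) : ℝ :=
  ∑ σ : Equiv.Perm (Fin k), ((Equiv.Perm.sign σ : ℤ) : ℝ) *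
    ∏ i ∈ Finset.univ.filter (fun i : Fin k => ∀ j, σ.SameCycle i j → i ≤ j),
      (cycleProduct a σ i).re

/-- A simple random point field on `ℝ³`: a random integer-valued Radon measure all of whose
points have multiplicity at most one. -/
structure IsSimplePointField {Ω : Type*} [MeasurableSpace Ω] (ℙ : Measure Ω)
    (X : Ω → Measure Space) : Prop where
  measurable : Measurable X
  radon : ∀ᵐ ω ∂ℙ, ∀ C : Set Space, IsCompact C → X ω C < ⊤
  integer_valued : ∀ᵐ ω ∂ℙ, ∀ A : Set Space, MeasurableSet A → ∃ N : ℕ∞, X ω A = (N : ENNReal)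
  simple : ∀ᵐ ω ∂ℙ, ∀ x : Space, X ω {x} ≤ 1

/-- The falling factorial `x (x - 1) ⋯ (x - k + 1)` of a number of points. -/
def fallingFactorial (x : ENNReal) (k : ℕ) : ENNReal :=
  ∏ j ∈ Finset.range k, (x - (j : ENNReal))

/-- `R` is the `k`-point correlation function of `X` with respect to `μ`. The monotone labelling
`c` lists the sets of the product `A_1 ^ k_1 × ⋯ × A_m ^ k_m`, so `k_i` is the number of
coordinates with label `i`. -/
def IsCorrelationFunction {Ω : Type*} [MeasurableSpace Ω] (ℙ : Measure Ω)
    (X : Ω → Measure Space) (μ : Measure Space) (k : ℕ) (R : (Fin k → Space) → ℝ) : Prop :=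
  (∀ x, 0 ≤ R x) ∧
  LocallyIntegrable R (Measure.pi fun _ => μ) ∧
  ∀ (m : ℕ) (A : Fin m → Set Space) (c : Fin k → Fin m),
    (∀ i, MeasurableSet (A i)) → Pairwise (fun i j => Disjoint (A i) (A j)) → Monotone c →
    ∫⁻ ω, ∏ i, fallingFactorial (X ω (A i)) (Finset.univ.filter fun j => c j = i).card ∂ℙ =
      ∫⁻ x in Set.univ.pi (fun j => A (c j)), ENNReal.ofReal (R x) ∂(Measure.pi fun _ => μ)

/-- `X` is the (simple) determinantal random point field on `ℝ³` with background measure `μ` and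
quaternion kernel `K`: all its correlation functions are Dyson-Moore determinants of `K`. -/
def IsDeterminantalField {Ω : Type*} [MeasurableSpace Ω] (ℙ : Measure Ω)
    (X : Ω → Measure Space) (μ : Measure Space) (K : Space → Space → ℍ[ℝ]) : Prop :=
  IsSimplePointField ℙ X ∧
  ∀ k : ℕ, IsCorrelationFunction ℙ X μ k (fun x => dysonMooreDet fun i j => K (x i) (x j))

/-- `ρ` is a density of the field `X` with respect to Lebesgue measure: the expected number of
points in `A` is the integral of `ρ` over `A`. -/
def IsFieldDensity {Ω : Type*} [MeasurableSpace Ω] (ℙ : Measure Ω)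
    (X : Ω → Measure Space) (ρ : Space → ℝ) : Prop :=
  (∀ x, 0 ≤ ρ x) ∧
  ∀ A : Set Space, MeasurableSet A → ∫⁻ ω, X ω A ∂ℙ = ∫⁻ x in A, ENNReal.ofReal (ρ x)

/-- The density `ρ_n` with respect to Lebesgue measure: the one-point correlation function
`K_n(x, x)` (a real number) times the density of the background measure. -/
def fieldDensity (n : ℕ) (x : Space) : ℝ := (kernel n x x).re * gaussDensity x

/-- The surface measure on the sphere `r S²`, for `r ≥ 0`: the image under `u ↦ r u` of `r²` times
the surface measure (induced by Lebesgue measure) of the unit sphere. -/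
def sphereMeasure (r : ℝ) : Measure Space :=
  ENNReal.ofReal (r ^ 2) •
    (Measure.toSphere (volume : Measure Space)).map
      (fun u : Metric.sphere (0 : Space) 1 => r • (u : Space))

/-- The radial density `p_n(r) = ∫_{r S²} ρ_n`. -/
def radialDensity (n : ℕ) (r : ℝ) : ℝ := ∫ x, fieldDensity n x ∂(sphereMeasure r)

end QuaternionField

end

/-! ### Algebra of the scalar product: Hermite polynomials of imaginary argument and their
Christoffel modification. -/

noncomputable section

namespace QuaternionField

open Polynomial

/-! On real polynomials the scalar product is one-dimensional. A pure quaternion satisfies `z² =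
-|z|²` and `star z = -z`, and the spherical Jacobian `r²` turns the Gaussian integral over `ℝ³` into
the integral of `conj (a(ir)) b(ir) r²` against the standard Gaussian on the line. So the `P_k` have
real coefficients and are orthogonal for `r²` times a Gaussian. By Christoffel's construction, `X
P_k` is the Hermite polynomial of degree `k + 1` (imaginary argument) minus the multiple of the
evaluation kernel at `0` that makes it vanish there (`orthoPoly_eq`).

Consequently `|x|² K_n(x, x)` is the reproducing kernel of the polynomials of degree at most `n`
that vanish at `0`: the diagonal Hermite kernel of order `n + 1` minus a rank-one term
(`norm_sq_mul_kernel_self_re`). The sphere area cancels `|x|²`, so the radial density is twice the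
GUE density of order `n + 1`, up to that term (`radialDensity_eq`).

The semicircle comes from the oscillator equation `w'' + q w = 0`, with `q = n + 1/2 - x²/4` and `w
= He_n exp(-x²/4)`. By Christoffel–Darboux the weighted diagonal kernel is the energy `E = w'² + q
w²` over `n!`, up to a multiple of `w²` (`sum_herm_sq_mul_exp`). The ratio `E / √q` is an adiabatic
invariant (`abs_hermEnergy_sub_le`), which produces the factor `√(1 - s²)`; Wallis' product gives
`E(0)` (`tendsto_hermEnergy_zero`). After normalization the `w²` and rank-one terms are `O(1/n)`.
For `s > 1` no asymptotics are needed: `E` decreases, so the density is dominated by the energy at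
any `t < 1`, whose limit vanishes as `t → 1`. -/

/-- The moments of the "Gaussian law of variance `-1`". -/
def imagMoment : ℕ → ℝ
  | 0 => 1
  | 1 => 0
  | n + 2 => -(n + 1) * imagMoment n

/-- The linear functional on polynomials with moments `imagMoment`. -/
def momentFunctional : ℝ[X] →ₗ[ℝ] ℝ :=
  Polynomial.lsum fun n => imagMoment n • LinearMap.id

lemma momentFunctional_monomial (n : ℕ) (a : ℝ) :
    momentFunctional (monomial n a) = imagMoment n * a := by
  simp [momentFunctional, Polynomial.lsum, sum_monomial_index]

lemma momentFunctional_X_pow (n : ℕ) : momentFunctional (X ^ n) = imagMoment n := by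
  rw [X_pow_eq_monomial, momentFunctional_monomial, mul_one]

/-- Gaussian integration by parts; the sign reflects the variance `-1`. -/
lemma momentFunctional_X_mul (q : ℝ[X]) :
    momentFunctional (X * q) = -momentFunctional (derivative q) := by
  induction q using Polynomial.induction_on' with
  | add p q hp hq => simp only [mul_add, map_add, hp, hq, neg_add]
  | monomial n a =>
    rw [X_mul_monomial, derivative_monomial, momentFunctional_monomial, momentFunctional_monomial]
    rcases n with _ | n
    · simp [imagMoment]
    · simp [imagMoment]; ring

lemma imagMoment_odd (m : ℕ) : imagMoment (2 * m + 1) = 0 := by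
  induction m with
  | zero => rfl
  | succ m ih =>
    rw [show 2 * (m + 1) + 1 = (2 * m + 1) + 2 by ring, imagMoment, ih, mul_zero]

lemma momentFunctional_aeval_neg_X (q : ℝ[X]) :
    momentFunctional (aeval (-X : ℝ[X]) q) = momentFunctional q := by
  induction q using Polynomial.induction_on' with
  | add p q hp hq => simp only [map_add, hp, hq]
  | monomial n a =>
    rw [aeval_monomial, algebraMap_eq, ← smul_eq_C_mul, map_smul, momentFunctional_monomial,
      neg_pow, show ((-1 : ℝ[X]) ^ n) = C ((-1) ^ n) by simp, ← smul_eq_C_mul, map_smul,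
      momentFunctional_X_pow]
    rcases Nat.even_or_odd' n with ⟨m, rfl | rfl⟩
    · simp [mul_comm]
    · simp [imagMoment_odd]

/-- The bilinear form `(a, b) ↦ Λ (a(-X) b(X))`, with `Λ` the functional `momentFunctional`. -/
def imagForm : ℝ[X] →ₗ[ℝ] ℝ[X] →ₗ[ℝ] ℝ :=
  ((LinearMap.mul ℝ ℝ[X]).compr₂ momentFunctional) ∘ₗ (aeval (-X : ℝ[X])).toLinearMap

lemma imagForm_apply (a b : ℝ[X]) :
    imagForm a b = momentFunctional (aeval (-X : ℝ[X]) a * b) := rfl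

lemma aeval_neg_X_aeval_neg_X (q : ℝ[X]) : aeval (-X : ℝ[X]) (aeval (-X : ℝ[X]) q) = q := by
  induction q using Polynomial.induction_on' with
  | add p q hp hq => simp only [map_add, hp, hq]
  | monomial n a => simp [aeval_monomial, C_mul_X_pow_eq_monomial]

/-- The odd moments vanish, so the functional is invariant under `X ↦ -X`, which exchanges the two
roles. -/
lemma imagForm_comm (a b : ℝ[X]) : imagForm a b = imagForm b a := by
  rw [imagForm_apply, imagForm_apply, ← momentFunctional_aeval_neg_X, map_mul,
    aeval_neg_X_aeval_neg_X, mul_comm]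

/-- A polynomial is the sum of its components along a monic orthogonal sequence. -/
lemma eq_sum_of_monic_orthogonal (B : ℝ[X] →ₗ[ℝ] ℝ[X] →ₗ[ℝ] ℝ) (p : ℕ → ℝ[X])
    (hm : ∀ k, (p k).Monic) (hd : ∀ k, (p k).natDegree = k)
    (ho : ∀ i j, i ≠ j → B (p i) (p j) = 0) (hn : ∀ k, B (p k) (p k) ≠ 0)
    (n : ℕ) : ∀ q : ℝ[X], q.degree < n →
      q = ∑ j ∈ Finset.range n, (B (p j) q / B (p j) (p j)) • p j := by
  induction n with
  | zero => intro q hq; simpa using hq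
  | succ n ih =>
    intro q hq
    have hpd : (p n).degree = n := by rw [degree_eq_natDegree (hm n).ne_zero, hd]
    set q' := q - q.coeff n • p n with hq'
    have hdeg : q'.degree < n := by
      rw [degree_lt_iff_coeff_zero]
      intro m hmn
      rcases hmn.eq_or_lt with rfl | h
      · have := hm n
        rw [Monic, leadingCoeff, hd] at this
        simp [hq', this]
      · have h1 : q.coeff m = 0 := by
          apply coeff_eq_zero_of_degree_lt
          refine lt_of_lt_of_le hq ?_
          exact_mod_cast h
        have h2 : (p n).coeff m = 0 := coeff_eq_zero_of_natDegree_lt (by rw [hd]; exact h)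
        simp [hq', h1, h2]
    have hqq : q = q' + q.coeff n • p n := by rw [hq']; ring
    have e := ih q' hdeg
    have hBn : B (p n) q' = 0 := by
      rw [e, map_sum]
      refine Finset.sum_eq_zero fun j hj => ?_
      rw [map_smul, ho n j (Finset.mem_range.1 hj).ne', smul_zero]
    rw [Finset.sum_range_succ]
    have h3 : ∀ j ∈ Finset.range n,
        (B (p j) q / B (p j) (p j)) • p j = (B (p j) q' / B (p j) (p j)) • p j := by
      intro j hj
      rw [hqq, map_add, map_smul, ho j n (Finset.mem_range.1 hj).ne, smul_zero, add_zero]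
    rw [Finset.sum_congr rfl h3, ← e]
    have h4 : B (p n) q / B (p n) (p n) = q.coeff n := by
      conv_lhs => rw [hqq]
      rw [map_add, map_smul, hBn, zero_add, smul_eq_mul, mul_div_assoc, div_self (hn n), mul_one]
    rw [h4]
    exact hqq

/-- The Hermite polynomials of imaginary argument, `H_n(x) = i⁻ⁿ He_n(i x)`. -/
def imagHermite : ℕ → ℝ[X]
  | 0 => 1
  | n + 1 => X * imagHermite n + derivative (imagHermite n)

lemma derivative_imagHermite_succ (n : ℕ) :
    derivative (imagHermite (n + 1)) = ((n : ℝ) + 1) • imagHermite n := by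
  induction n with
  | zero => simp [imagHermite]
  | succ n ih =>
    rw [imagHermite, derivative_add, derivative_mul, ih, derivative_X, one_mul, derivative_smul,
      mul_smul_comm, add_assoc, ← smul_add, ← imagHermite]
    push_cast
    module

lemma imagHermite_succ_succ (n : ℕ) :
    imagHermite (n + 2) = X * imagHermite (n + 1) + ((n : ℝ) + 1) • imagHermite n := by
  rw [imagHermite, derivative_imagHermite_succ]

lemma imagHermite_monic_natDegree (n : ℕ) :
    (imagHermite n).Monic ∧ (imagHermite n).natDegree = n := by
  induction n with
  | zero => simp [imagHermite]
  | succ n ih =>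
    obtain ⟨h1, h2⟩ := ih
    have hX : (X * imagHermite n).Monic := monic_X.mul h1
    have hXd : (X * imagHermite n).natDegree = n + 1 := by
      rw [natDegree_X_mul h1.ne_zero, h2]
    have hlt : (derivative (imagHermite n)).degree < (X * imagHermite n).degree := by
      rw [degree_eq_natDegree hX.ne_zero, hXd]
      refine lt_of_le_of_lt degree_derivative_le ?_
      rw [degree_eq_natDegree h1.ne_zero, h2]
      exact_mod_cast Nat.lt_succ_self n
    refine ⟨hX.add_of_left hlt, ?_⟩
    rw [imagHermite, natDegree_add_eq_left_of_degree_lt hlt, hXd]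

lemma imagHermite_monic (n : ℕ) : (imagHermite n).Monic := (imagHermite_monic_natDegree n).1

lemma natDegree_imagHermite (n : ℕ) : (imagHermite n).natDegree = n :=
  (imagHermite_monic_natDegree n).2

lemma degree_imagHermite (n : ℕ) : (imagHermite n).degree = n := by
  rw [degree_eq_natDegree (imagHermite_monic n).ne_zero, natDegree_imagHermite]

lemma aeval_neg_X_imagHermite (n : ℕ) :
    aeval (-X : ℝ[X]) (imagHermite n) = ((-1 : ℝ) ^ n) • imagHermite n := by
  induction n using Nat.twoStepInduction with
  | zero => simp [imagHermite]
  | one => simp [imagHermite]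
  | more n h1 h2 =>
    rw [imagHermite_succ_succ, map_add, map_mul, map_smul, h1, h2, aeval_X, pow_succ, pow_succ,
      mul_smul_comm, neg_mul]
    module

/-- Iterated integration by parts (Rodrigues): in the recursion for `imagHermite`, the terms
containing the derivative of `imagHermite n` cancel and one derivative falls on `q`. -/
lemma momentFunctional_imagHermite_mul (n : ℕ) (q : ℝ[X]) :
    momentFunctional (imagHermite n * q) = (-1) ^ n * momentFunctional (derivative^[n] q) := by
  induction n generalizing q with
  | zero => simp [imagHermite]
  | succ n ih =>
    have : imagHermite (n + 1) * q = X * (imagHermite n * q) + derivative (imagHermite n) * q := by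
      rw [imagHermite]; ring
    rw [this, map_add, momentFunctional_X_mul, derivative_mul, map_add, ih,
      Function.iterate_succ_apply]
    ring

/-- The parity sign of `imagHermite n` cancels the sign from `n` integrations by parts.
Orthogonality and the positive norms `n!` both follow from this formula. -/
lemma imagForm_imagHermite (n : ℕ) (q : ℝ[X]) :
    imagForm (imagHermite n) q = momentFunctional (derivative^[n] q) := by
  rw [imagForm_apply, aeval_neg_X_imagHermite, smul_mul_assoc, map_smul,
    momentFunctional_imagHermite_mul, smul_eq_mul, ← mul_assoc, ← mul_pow]
  simp

lemma iterate_derivative_imagHermite (n : ℕ) :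
    derivative^[n] (imagHermite n) = C (n.factorial : ℝ) := by
  induction n with
  | zero => simp [imagHermite]
  | succ n ih =>
    rw [Function.iterate_succ_apply, derivative_imagHermite_succ, iterate_derivative_smul, ih,
      smul_C, Nat.factorial_succ]
    simp

lemma imagForm_imagHermite_self (n : ℕ) :
    imagForm (imagHermite n) (imagHermite n) = n.factorial := by
  rw [imagForm_imagHermite, iterate_derivative_imagHermite, C_eq_algebraMap,
    Algebra.algebraMap_eq_smul_one, map_smul, ← pow_zero X, momentFunctional_X_pow]
  simp [imagMoment]

lemma imagForm_imagHermite_of_degree_lt {n : ℕ} {q : ℝ[X]} (h : q.degree < n) :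
    imagForm (imagHermite n) q = 0 := by
  rw [imagForm_imagHermite]
  by_cases hq : q = 0
  · simp [hq]
  · rw [iterate_derivative_eq_zero, map_zero]
    rwa [degree_eq_natDegree hq, Nat.cast_lt] at h

lemma imagForm_imagHermite_of_ne {i j : ℕ} (h : i ≠ j) :
    imagForm (imagHermite i) (imagHermite j) = 0 := by
  rcases h.lt_or_gt with h | h
  · rw [imagForm_comm]
    exact imagForm_imagHermite_of_degree_lt (by rw [degree_imagHermite]; exact_mod_cast h)
  · exact imagForm_imagHermite_of_degree_lt (by rw [degree_imagHermite]; exact_mod_cast h)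

/-! ### Christoffel modification at the origin. -/

/-- The reproducing kernel at `0` of the polynomials of degree less than `n`. -/
def evalKernel (n : ℕ) : ℝ[X] :=
  ∑ k ∈ Finset.range n, ((imagHermite k).eval 0 / k.factorial) • imagHermite k

lemma imagForm_evalKernel {n : ℕ} {q : ℝ[X]} (h : q.degree < n) :
    imagForm (evalKernel n) q = q.eval 0 := by
  have e := eq_sum_of_monic_orthogonal imagForm imagHermite imagHermite_monic natDegree_imagHermite
    (fun _ _ => imagForm_imagHermite_of_ne)
    (fun k => by rw [imagForm_imagHermite_self]; positivity) n q h
  conv_rhs => rw [e]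
  rw [evalKernel, map_sum, LinearMap.sum_apply, eval_finsetSum]
  refine Finset.sum_congr rfl fun k _ => ?_
  rw [map_smul, LinearMap.smul_apply, eval_smul, imagForm_imagHermite_self, smul_eq_mul,
    smul_eq_mul]
  ring

lemma degree_evalKernel_lt (n : ℕ) : (evalKernel n).degree < n := by
  refine (degree_sum_le _ _).trans_lt ((Finset.sup_lt_iff (WithBot.bot_lt_coe n)).2 ?_)
  intro k hk
  refine (degree_smul_le _ _).trans_lt ?_
  rw [degree_imagHermite]
  exact WithBot.coe_lt_coe.2 (Finset.mem_range.1 hk)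

lemma evalKernel_eval_zero (n : ℕ) :
    (evalKernel n).eval 0 = ∑ k ∈ Finset.range n, (imagHermite k).eval 0 ^ 2 / k.factorial := by
  rw [evalKernel, eval_finsetSum]
  refine Finset.sum_congr rfl fun k _ => ?_
  rw [eval_smul, smul_eq_mul]; ring

lemma one_le_evalKernel_eval_zero (n : ℕ) : 1 ≤ (evalKernel (n + 1)).eval 0 := by
  rw [evalKernel_eval_zero, Finset.sum_range_succ']
  have : 0 ≤ ∑ k ∈ Finset.range n, (imagHermite (k + 1)).eval 0 ^ 2 / (k + 1).factorial := by
    positivity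
  simpa [imagHermite] using this

/-- The quotient of the part of `H_{n+1}` orthogonal to the polynomials of degree at most `n`
vanishing at `0`, corrected to vanish at `0`, by `X`. -/
def christoffelPoly (n : ℕ) : ℝ[X] :=
  divX (imagHermite (n + 1) -
    ((imagHermite (n + 1)).eval 0 / (evalKernel (n + 1)).eval 0) • evalKernel (n + 1))

lemma X_mul_christoffelPoly (n : ℕ) :
    X * christoffelPoly n = imagHermite (n + 1) -
      ((imagHermite (n + 1)).eval 0 / (evalKernel (n + 1)).eval 0) • evalKernel (n + 1) := by
  conv_rhs => rw [← X_mul_divX_add (imagHermite (n + 1) -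
    ((imagHermite (n + 1)).eval 0 / (evalKernel (n + 1)).eval 0) • evalKernel (n + 1))]
  have := one_le_evalKernel_eval_zero n
  rw [coeff_zero_eq_eval_zero, eval_sub, eval_smul, smul_eq_mul, div_mul_cancel₀ _ (by linarith),
    sub_self, C_0, add_zero, christoffelPoly]

lemma X_mul_christoffelPoly_monic_degree (n : ℕ) :
    (X * christoffelPoly n).Monic ∧ (X * christoffelPoly n).degree = ((n + 1 : ℕ) : WithBot ℕ) := by
  have hlt : (((imagHermite (n + 1)).eval 0 / (evalKernel (n + 1)).eval 0) •
      evalKernel (n + 1)).degree < (imagHermite (n + 1)).degree := by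
    rw [degree_imagHermite]
    exact (degree_smul_le _ _).trans_lt (degree_evalKernel_lt _)
  rw [X_mul_christoffelPoly]
  exact ⟨(imagHermite_monic _).sub_of_left hlt,
    by rw [degree_sub_eq_left_of_degree_lt hlt, degree_imagHermite]⟩

lemma christoffelPoly_monic (n : ℕ) : (christoffelPoly n).Monic :=
  Monic.of_mul_monic_left monic_X (X_mul_christoffelPoly_monic_degree n).1

lemma natDegree_christoffelPoly (n : ℕ) : (christoffelPoly n).natDegree = n := by
  have h := (X_mul_christoffelPoly_monic_degree n).2
  have h2 := natDegree_eq_of_degree_eq_some h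
  rw [natDegree_X_mul (christoffelPoly_monic n).ne_zero] at h2
  omega

/-- The form `(a, b) ↦ imagForm (X a) (X b)`. -/
def pureForm : ℝ[X] →ₗ[ℝ] ℝ[X] →ₗ[ℝ] ℝ :=
  imagForm.compl₁₂ (LinearMap.mulLeft ℝ X) (LinearMap.mulLeft ℝ X)

lemma pureForm_apply (a b : ℝ[X]) : pureForm a b = imagForm (X * a) (X * b) := rfl

lemma pureForm_comm (a b : ℝ[X]) : pureForm a b = pureForm b a := by
  rw [pureForm_apply, imagForm_comm, pureForm_apply]

/-- The Hermite part is orthogonal to every polynomial of lower degree, and pairing with the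
evaluation kernel gives the value of `X * christoffelPoly j` at `0`, which is zero. -/
lemma pureForm_christoffelPoly_of_lt {i j : ℕ} (h : j < i) :
    pureForm (christoffelPoly i) (christoffelPoly j) = 0 := by
  have hd : (X * christoffelPoly j).degree < ((i + 1 : ℕ) : WithBot ℕ) := by
    rw [(X_mul_christoffelPoly_monic_degree j).2]
    exact_mod_cast Nat.succ_lt_succ h
  rw [pureForm_apply, X_mul_christoffelPoly i, map_sub, map_smul, LinearMap.sub_apply,
    LinearMap.smul_apply, imagForm_imagHermite_of_degree_lt hd, imagForm_evalKernel hd]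
  simp

lemma pureForm_christoffelPoly_of_ne (i j : ℕ) (h : i ≠ j) :
    pureForm (christoffelPoly i) (christoffelPoly j) = 0 := by
  rcases h.lt_or_gt with h | h
  · rw [pureForm_comm]
    exact pureForm_christoffelPoly_of_lt h
  · exact pureForm_christoffelPoly_of_lt h

/-- Pythagoras: the Hermite polynomial is orthogonal to the evaluation kernel, whose squared norm is
its own value at `0`. -/
lemma pureForm_christoffelPoly_self (n : ℕ) :
    pureForm (christoffelPoly n) (christoffelPoly n) = (n + 1).factorial +
      (imagHermite (n + 1)).eval 0 ^ 2 / (evalKernel (n + 1)).eval 0 := by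
  have := one_le_evalKernel_eval_zero n
  have hlt := degree_evalKernel_lt (n + 1)
  have key : ∀ (a b : ℝ[X]) (c : ℝ), imagForm a b = 0 →
      imagForm (a - c • b) (a - c • b) = imagForm a a + c ^ 2 * imagForm b b := by
    intro a b c h
    have h' : imagForm b a = 0 := by rw [imagForm_comm, h]
    rw [LinearMap.map_sub₂, map_sub, map_sub, map_smul, LinearMap.map_smul₂,
      LinearMap.map_smul₂, map_smul, h, h', smul_eq_mul, smul_eq_mul,
      smul_eq_mul]
    ring
  rw [pureForm_apply, X_mul_christoffelPoly, key _ _ _ (imagForm_imagHermite_of_degree_lt hlt),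
    imagForm_imagHermite_self, imagForm_evalKernel hlt]
  field_simp

lemma pureForm_christoffelPoly_self_pos (n : ℕ) :
    0 < pureForm (christoffelPoly n) (christoffelPoly n) := by
  have := one_le_evalKernel_eval_zero n
  rw [pureForm_christoffelPoly_self]
  positivity

/-- The Gram-Schmidt recursion for `christoffelPoly`. -/
lemma christoffelPoly_eq (k : ℕ) :
    christoffelPoly k = X ^ k - ∑ j ∈ Finset.range k,
      ((pureForm (christoffelPoly j) (christoffelPoly j))⁻¹ *
        pureForm (christoffelPoly j) (X ^ k)) • christoffelPoly j := by
  have hlt : (X ^ k - christoffelPoly k).degree < (k : WithBot ℕ) := by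
    have hm := christoffelPoly_monic k
    have hd : (christoffelPoly k).degree = k := by
      rw [degree_eq_natDegree hm.ne_zero, natDegree_christoffelPoly]
    have := degree_sub_lt_left (p := X ^ k) (q := christoffelPoly k) (by rw [hd, degree_X_pow])
      (monic_X_pow k).ne_zero (by rw [hm.leadingCoeff, (monic_X_pow k).leadingCoeff])
    rwa [degree_X_pow] at this
  have e := eq_sum_of_monic_orthogonal pureForm christoffelPoly christoffelPoly_monic
    natDegree_christoffelPoly pureForm_christoffelPoly_of_ne
    (fun k => (pureForm_christoffelPoly_self_pos k).ne') k _ hlt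
  rw [eq_sub_iff_add_eq', ← eq_sub_iff_add_eq]
  rw [e]
  refine Finset.sum_congr rfl fun j hj => ?_
  rw [map_sub, pureForm_christoffelPoly_of_ne j k (Finset.mem_range.1 hj).ne, sub_zero,
    div_eq_inv_mul]

end QuaternionField
end

/-! ### Gaussian integrals over pure quaternions, the orthogonal polynomials and the one-point
density. -/

noncomputable section

namespace QuaternionField

open Polynomial

@[simp] lemma re_toPure (x : Space) : (toPure x).re = 0 := rfl

@[simp] lemma imI_toPure (x : Space) : (toPure x).imI = x 0 := rfl

@[simp] lemma imJ_toPure (x : Space) : (toPure x).imJ = x 1 := rfl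

@[simp] lemma imK_toPure (x : Space) : (toPure x).imK = x 2 := rfl

lemma continuous_toPure : Continuous toPure := by
  have h : toPure = fun x : Space =>
      (Quaternion.linearIsometryEquivTuple.symm (WithLp.toLp 2 ![0, x 0, x 1, x 2])) := by
    funext x
    apply Quaternion.linearIsometryEquivTuple.injective
    rw [LinearIsometryEquiv.apply_symm_apply]
    ext i
    fin_cases i <;> rfl
  rw [h]
  refine (LinearIsometryEquiv.continuous _).comp ((PiLp.continuous_toLp 2 _).comp ?_)
  refine continuous_pi fun i => ?_
  fin_cases i <;> simp <;> fun_prop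

lemma star_toPure (x : Space) : star (toPure x) = -toPure x := by
  ext <;> simp

lemma toPure_neg (x : Space) : toPure (-x) = -toPure x := by
  ext <;> simp

lemma normSq_toPure (x : Space) : Quaternion.normSq (toPure x) = ‖x‖ ^ 2 := by
  rw [Quaternion.normSq_def', EuclideanSpace.norm_sq_eq, Fin.sum_univ_three]
  simp

lemma norm_toPure (x : Space) : ‖toPure x‖ = ‖x‖ := by
  rw [← sq_eq_sq₀ (norm_nonneg _) (norm_nonneg _), sq, ← Quaternion.normSq_eq_norm_mul_self,
    normSq_toPure]

lemma toPure_mul_self (x : Space) : toPure x * toPure x = ((-‖x‖ ^ 2 : ℝ) : ℍ[ℝ]) := by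
  have h := Quaternion.self_mul_star (toPure x)
  rw [star_toPure, normSq_toPure, mul_neg] at h
  rw [neg_eq_iff_eq_neg.1 h]
  simp

lemma toPure_pow_even (x : Space) (m : ℕ) :
    toPure x ^ (2 * m) = (((-1) ^ m * ‖x‖ ^ (2 * m) : ℝ) : ℍ[ℝ]) := by
  rw [pow_mul, sq, toPure_mul_self, ← Quaternion.coe_pow, neg_pow, ← pow_mul]

lemma continuous_gaussDensity : Continuous gaussDensity := by
  unfold gaussDensity; fun_prop

lemma gaussDensity_pos (x : Space) : 0 < gaussDensity x := by
  unfold gaussDensity; positivity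

lemma integral_background {E : Type*} [NormedAddCommGroup E] [NormedSpace ℝ E] (F : Space → E) :
    ∫ x, F x ∂background = ∫ x, gaussDensity x • F x := by
  rw [background, integral_withDensity_eq_integral_toReal_smul
    (continuous_gaussDensity.measurable.ennreal_ofReal) (by simp)]
  simp_rw [ENNReal.toReal_ofReal (gaussDensity_pos _).le]

lemma integrable_background_iff {E : Type*} [NormedAddCommGroup E] [NormedSpace ℝ E]
    (F : Space → E) :
    Integrable F background ↔ Integrable fun x => gaussDensity x • F x := by
  rw [background, integrable_withDensity_iff_integrable_smul'
    (continuous_gaussDensity.measurable.ennreal_ofReal) (by simp)]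
  simp_rw [ENNReal.toReal_ofReal (gaussDensity_pos _).le]

lemma integrable_norm_pow_background (n : ℕ) :
    Integrable (fun x : Space => ‖x‖ ^ n) background := by
  rw [integrable_background_iff]
  have h := (integrable_fun_norm_addHaar (E := Space) volume
    (f := fun y : ℝ => ((2 * Real.pi) ^ (-(3 / 2) : ℝ) * Real.exp (-y ^ 2 / 2)) • y ^ n)).2
  refine h ?_
  have h2 := integrableOn_rpow_mul_exp_neg_mul_sq (b := 1 / 2) (by norm_num) (s := (n : ℝ) + 2)
    (by linarith [n.cast_nonneg (α := ℝ)])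
  refine IntegrableOn.congr_fun (h2.const_mul ((2 * Real.pi) ^ (-(3 / 2) : ℝ))) (fun y hy => ?_)
    measurableSet_Ioi
  have hn : y ^ ((n : ℝ) + 2) = y ^ (n + 2) := by exact_mod_cast Real.rpow_natCast y (n + 2)
  simp only [finrank_euclideanSpace, Fintype.card_fin, smul_eq_mul, hn]
  rw [show -(1 / 2) * y ^ 2 = -y ^ 2 / 2 by ring]
  ring

/-- In spherical coordinates this becomes the standard Gaussian moment of order `2m + 2` on the
line, because the Jacobian adds two to the exponent. -/
lemma integral_norm_pow_background (m : ℕ) :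
    ∫ x : Space, ‖x‖ ^ (2 * m) ∂background = (2 * m + 1).doubleFactorial := by
  rw [integral_background]
  have h := integral_fun_norm_addHaar (E := Space) volume
    (fun y : ℝ => ((2 * Real.pi) ^ (-(3 / 2) : ℝ) * Real.exp (-y ^ 2 / 2)) • y ^ (2 * m))
  refine h.trans ?_
  have h2 := integral_rpow_mul_exp_neg_mul_rpow (p := 2) (q := 2 * m + 2) (b := 1 / 2)
    (by norm_num) (by linarith [m.cast_nonneg (α := ℝ)]) (by norm_num)
  have h3 : ∫ y in Set.Ioi (0 : ℝ), y ^ (Module.finrank ℝ Space - 1) •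
      ((2 * Real.pi) ^ (-(3 / 2) : ℝ) * Real.exp (-y ^ 2 / 2)) • y ^ (2 * m) =
      (2 * Real.pi) ^ (-(3 / 2) : ℝ) *
      ∫ x in Set.Ioi (0 : ℝ), x ^ ((2 * m + 2 : ℝ)) * Real.exp (-(1 / 2) * x ^ (2 : ℝ)) := by
    rw [← integral_const_mul]
    refine setIntegral_congr_fun measurableSet_Ioi fun y hy => ?_
    have hn : y ^ (2 * (m : ℝ) + 2) = y ^ (2 * m + 2) := by
      exact_mod_cast Real.rpow_natCast y (2 * m + 2)
    have h2' : y ^ (2 : ℝ) = y ^ 2 := by exact_mod_cast Real.rpow_natCast y 2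
    simp only [finrank_euclideanSpace, Fintype.card_fin, smul_eq_mul, hn, h2']
    rw [show -(1 / 2) * y ^ 2 = -y ^ 2 / 2 by ring]
    ring
  rw [h3, h2, Measure.real, EuclideanSpace.volume_ball_fin_three, finrank_euclideanSpace,
    show (2 * (m : ℝ) + 2 + 1) / 2 = ((m + 1 : ℕ) : ℝ) + 1 / 2 by push_cast; ring,
    Real.Gamma_nat_add_half, show -(2 * (m : ℝ) + 2 + 1) / 2 = -((m : ℝ) + 3 / 2) by ring,
    show 2 * (m + 1) - 1 = 2 * m + 1 by omega, Real.rpow_neg (by positivity), Real.rpow_neg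
    (by positivity), Real.rpow_add (by norm_num), Real.rpow_natCast,
    show (3 / 2 : ℝ) = 1 + 1 / 2 by norm_num, Real.rpow_add (by positivity),
    Real.rpow_add (by positivity), ← Real.sqrt_eq_rpow, ← Real.sqrt_eq_rpow, Real.rpow_one,
    Real.rpow_one, Real.sqrt_mul (by norm_num), Real.sqrt_div (by norm_num), Real.sqrt_one]
  · simp only [Fintype.card_fin, ENNReal.ofReal_one, one_pow, one_mul, smul_eq_mul, nsmul_eq_mul]
    rw [ENNReal.toReal_ofReal (by positivity)]
    have hs2 : √(2 : ℝ) ≠ 0 := by positivity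
    have hsp : √Real.pi ≠ 0 := by positivity
    have hp := Real.pi_pos.ne'
    rw [one_div_pow]
    field_simp
    push_cast
    ring
  
lemma imagMoment_even (m : ℕ) :
    imagMoment (2 * m + 2) = -((-1) ^ m * (2 * m + 1).doubleFactorial) := by
  induction m with
  | zero => simp [imagMoment]
  | succ m ih =>
    rw [show 2 * (m + 1) + 2 = (2 * m + 2) + 2 by ring, imagMoment, ih,
      show 2 * (m + 1) + 1 = (2 * m + 1) + 2 by ring, Nat.doubleFactorial_add_two]
    push_cast
    ring

lemma integrable_toPure_pow (n : ℕ) : Integrable (fun x => toPure x ^ n) background := by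
  refine (integrable_norm_pow_background n).mono'
    (continuous_toPure.pow n).aestronglyMeasurable (ae_of_all _ fun x => ?_)
  rw [norm_pow, norm_toPure]

/-- Odd powers integrate to zero by the symmetry `x ↦ -x`; even powers are real. The shift by two in
the index is the Jacobian, and the minus sign appears because `r²` corresponds to `-X²`. -/
lemma integral_toPure_pow (n : ℕ) :
    ∫ x, toPure x ^ n ∂background = ((-imagMoment (n + 2) : ℝ) : ℍ[ℝ]) := by
  rcases Nat.even_or_odd' n with ⟨m, rfl | rfl⟩
  · simp_rw [toPure_pow_even, Quaternion.coe_mul]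
    have h : ∫ x : Space, (((-1) ^ m : ℝ) : ℍ[ℝ]) * ((‖x‖ ^ (2 * m) : ℝ) : ℍ[ℝ]) ∂background =
        (((-1) ^ m : ℝ) : ℍ[ℝ]) * ((∫ x : Space, ‖x‖ ^ (2 * m) ∂background : ℝ) : ℍ[ℝ]) := by
      have h1 := ((Algebra.linearMap ℝ ℍ[ℝ]).toContinuousLinearMap).integral_comp_comm
        (integrable_norm_pow_background (2 * m))
      simp only [LinearMap.coe_toContinuousLinearMap', Algebra.linearMap_apply] at h1
      exact (((ContinuousLinearMap.mul ℝ ℍ[ℝ]) (((-1) ^ m : ℝ) : ℍ[ℝ])).integral_comp_comm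
        ((Algebra.linearMap ℝ ℍ[ℝ]).toContinuousLinearMap.integrable_comp
        (integrable_norm_pow_background (2 * m)))).trans (congrArg _ h1)
    rw [h, integral_norm_pow_background, imagMoment_even, neg_neg, Quaternion.coe_mul]
  · rw [show 2 * m + 1 + 2 = 2 * (m + 1) + 1 by ring, imagMoment_odd, neg_zero,
      Quaternion.coe_zero, integral_background]
    have h := integral_neg_eq_self (fun x : Space => gaussDensity x • toPure x ^ (2 * m + 1))
      volume
    have h2 : ∀ x : Space, gaussDensity (-x) • toPure (-x) ^ (2 * m + 1) =
        -(gaussDensity x • toPure x ^ (2 * m + 1)) := by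
      intro x
      rw [toPure_neg, Odd.neg_pow ⟨m, rfl⟩, smul_neg, gaussDensity, norm_neg, gaussDensity]
    simp_rw [h2] at h
    rw [integral_neg] at h
    refine (smul_eq_zero.1 ?_).resolve_left (two_ne_zero (α := ℝ))
    rw [two_smul]
    nth_rewrite 1 [← h]
    exact neg_add_cancel _

lemma aeval_toPure_eq_sum (q : ℝ[X]) (x : Space) :
    aeval (toPure x) q = ∑ i ∈ Finset.range (q.natDegree + 1), q.coeff i • toPure x ^ i :=
  aeval_eq_sum_range _

lemma continuous_aeval_toPure (q : ℝ[X]) : Continuous fun x => aeval (toPure x) q :=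
  (Polynomial.continuous_aeval q).comp continuous_toPure

lemma integral_aeval_toPure (q : ℝ[X]) :
    ∫ x, aeval (toPure x) q ∂background = ((-momentFunctional (X ^ 2 * q) : ℝ) : ℍ[ℝ]) := by
  simp_rw [aeval_toPure_eq_sum]
  rw [integral_finsetSum _ fun i _ => (integrable_toPure_pow i).fun_smul _]
  simp_rw [integral_smul, integral_toPure_pow]
  conv_rhs => rw [q.as_sum_range_C_mul_X_pow, Finset.mul_sum]
  rw [map_sum, ← Finset.sum_neg_distrib]
  have e := map_sum (algebraMap ℝ ℍ[ℝ])
    (fun i => -momentFunctional (X ^ 2 * (C (q.coeff i) * X ^ i))) (Finset.range (q.natDegree + 1))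
  rw [Quaternion.algebraMap_def] at e
  rw [e]
  refine Finset.sum_congr rfl fun i _ => ?_
  rw [show X ^ 2 * (C (q.coeff i) * X ^ i) = q.coeff i • X ^ (i + 2) by
    rw [smul_eq_C_mul]; ring, map_smul, momentFunctional_X_pow, smul_eq_mul, ← mul_neg,
    Quaternion.coe_mul, Quaternion.coe_mul_eq_smul]

lemma star_aeval_toPure (q : ℝ[X]) (x : Space) :
    star (aeval (toPure x) q) = aeval (toPure x) (aeval (-X : ℝ[X]) q) := by
  induction q using Polynomial.induction_on' with
  | add p q hp hq => simp only [map_add, star_add, hp, hq]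
  | monomial n a =>
    rw [aeval_monomial, aeval_monomial, map_mul, map_pow, map_neg, aeval_X, star_mul, star_pow,
      star_toPure]
    have h1 : star (algebraMap ℝ ℍ[ℝ] a) = algebraMap ℝ ℍ[ℝ] a := Quaternion.star_coe a
    rw [h1, algebraMap_eq, aeval_C, Algebra.commutes]

/-- Conjugation acts as `X ↦ -X`, and the Jacobian `-X² = (-X) X` supplies one factor `X` to each
argument. -/
lemma scalarProduct_aeval (a b : ℝ[X]) :
    scalarProduct (fun z => aeval (toPure z) a) (fun z => aeval (toPure z) b) =
      ((pureForm a b : ℝ) : ℍ[ℝ]) := by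
  unfold scalarProduct
  simp_rw [star_aeval_toPure, ← map_mul]
  rw [integral_aeval_toPure, pureForm_apply, imagForm_apply, map_mul (aeval (-X : ℝ[X])), aeval_X,
    ← map_neg]
  congr 2
  ring

lemma normSquare_aeval (a : ℝ[X]) :
    normSquare (fun z => aeval (toPure z) a) = pureForm a a := by
  rw [normSquare, scalarProduct_aeval, Quaternion.re_coe]

/-- Inductively all Gram–Schmidt coefficients are real, hence central, so the quaternionic recursion
coincides with the real one in `christoffelPoly_eq`. -/
lemma orthoPoly_eq (k : ℕ) : orthoPoly k = fun z => aeval (toPure z) (christoffelPoly k) := by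
  induction k using Nat.strong_induction_on with
  | _ k ih =>
    funext z
    rw [orthoPoly, christoffelPoly_eq k, map_sub, map_pow, aeval_X, map_sum]
    congr 1
    rw [← Fin.sum_univ_eq_sum_range (fun j => aeval (toPure z)
      (((pureForm (christoffelPoly j) (christoffelPoly j))⁻¹ *
        pureForm (christoffelPoly j) (X ^ k)) • christoffelPoly j))]
    refine Finset.sum_congr rfl fun j _ => ?_
    have hp : (fun w => toPure w ^ k) = fun w => aeval (toPure w) ((X : ℝ[X]) ^ k) := by
      funext w; rw [map_pow, aeval_X]
    rw [ih j j.2, normSquare_aeval, hp, scalarProduct_aeval, map_smul, mul_smul_comm, mul_smul,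
      Quaternion.mul_coe_eq_smul]

lemma kernel_self_re (n : ℕ) (x : Space) :
    (kernel n x x).re = ∑ k ∈ Finset.range n, ‖aeval (toPure x) (christoffelPoly k)‖ ^ 2 /
      pureForm (christoffelPoly k) (christoffelPoly k) := by
  rw [kernel, show (∑ k ∈ Finset.range n, (normSquare (orthoPoly k))⁻¹ •
      (orthoPoly k x * star (orthoPoly k x))).re = ∑ k ∈ Finset.range n,
      ((normSquare (orthoPoly k))⁻¹ • (orthoPoly k x * star (orthoPoly k x))).re from
    map_sum (QuaternionAlgebra.reₗ (-1 : ℝ) 0 (-1)) _ _]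
  refine Finset.sum_congr rfl fun k _ => ?_
  rw [orthoPoly_eq, normSquare_aeval, Quaternion.self_mul_star,
    Quaternion.normSq_eq_norm_mul_self, Quaternion.re_smul, Quaternion.re_coe, smul_eq_mul,
    div_eq_inv_mul, sq]

lemma kernel_self_re_nonneg (n : ℕ) (x : Space) : 0 ≤ (kernel n x x).re := by
  rw [kernel_self_re]
  exact Finset.sum_nonneg fun k _ =>
    div_nonneg (sq_nonneg _) (pureForm_christoffelPoly_self_pos k).le

lemma continuous_fieldDensity (n : ℕ) : Continuous (fieldDensity n) := by
  unfold fieldDensity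
  simp_rw [kernel_self_re]
  refine Continuous.mul (continuous_finsetSum _ fun k _ => ?_) continuous_gaussDensity
  exact ((continuous_aeval_toPure _).norm.pow 2).div_const _

lemma dysonMooreDet_one (a : Fin 1 → Fin 1 → ℍ[ℝ]) : dysonMooreDet a = (a 0 0).re := by
  unfold dysonMooreDet
  rw [Fintype.sum_unique, show (default : Equiv.Perm (Fin 1)) = 1 from Subsingleton.elim _ _]
  simp [cycleProduct, Finset.filter_true_of_mem]

theorem isFieldDensity_fieldDensity (n : ℕ) {Ω : Type*} [MeasurableSpace Ω] (ℙ : Measure Ω)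
    (X : Ω → Measure Space) (hX : IsDeterminantalField ℙ X background (kernel n)) :
    IsFieldDensity ℙ X (fieldDensity n) := by
  refine ⟨fun x => mul_nonneg (kernel_self_re_nonneg n x) (gaussDensity_pos x).le,
    fun A hA => ?_⟩
  -- The first correlation function tested on the single set `A`: the falling factorial of order one
  -- is the point count itself.
  have h := (hX.2 1).2.2 1 (fun _ => A) (fun _ => 0) (fun _ => hA)
    (fun i j hij => absurd (Subsingleton.elim i j) hij) (fun _ _ _ => le_rfl)
  have hc : (Finset.univ.filter fun _ : Fin 1 => (0 : Fin 1) = default).card = 1 := rfl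
  simp only [Fintype.prod_unique, dysonMooreDet_one, hc, fallingFactorial, Finset.prod_range_one,
    Nat.cast_zero, tsub_zero] at h
  refine h.trans ?_
  have hc : Continuous fun x => (kernel n x x).re := by
    simp_rw [kernel_self_re]
    exact continuous_finsetSum _ fun k _ => ((continuous_aeval_toPure _).norm.pow 2).div_const _
  have hm : Measurable fun x => ENNReal.ofReal (kernel n x x).re := hc.measurable.ennreal_ofReal
  have hpre := measurePreserving_funUnique background (Fin 1)
  have e : (Set.univ.pi fun _ : Fin 1 => A) =
      (MeasurableEquiv.funUnique (Fin 1) Space) ⁻¹' A := by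
    ext x
    simp [MeasurableEquiv.funUnique]
  rw [e]
  have h2 := hpre.setLIntegral_comp_preimage hA hm
  refine Eq.trans ?_ (h2.trans ?_)
  · rfl
  · rw [background, restrict_withDensity hA, lintegral_withDensity_eq_lintegral_mul _
      continuous_gaussDensity.measurable.ennreal_ofReal hm]
    refine lintegral_congr fun x => ?_
    rw [Pi.mul_apply, fieldDensity, mul_comm, ENNReal.ofReal_mul (kernel_self_re_nonneg n x)]

end QuaternionField
end

/-! ### Hermite functions, the oscillator energy and Christoffel–Darboux formulas. -/

noncomputable section

namespace QuaternionField

/-- The (probabilists') Hermite polynomials, as functions on `ℝ`. -/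
def herm : ℕ → ℝ → ℝ
  | 0, _ => 1
  | 1, x => x
  | n + 2, x => x * herm (n + 1) x - (n + 1) * herm n x

lemma herm_succ (n : ℕ) (x : ℝ) : herm (n + 1) x = x * herm n x - n * herm (n - 1) x := by
  rcases n with _ | n
  · simp [herm]
  · rw [herm]; simp

lemma hasDerivAt_herm (n : ℕ) (x : ℝ) : HasDerivAt (herm n) (n * herm (n - 1) x) x := by
  induction n using Nat.twoStepInduction with
  | zero => simpa [herm] using hasDerivAt_const x (1 : ℝ)
  | one => simpa [herm] using hasDerivAt_id' x
  | more n h1 h2 =>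
    have h := ((hasDerivAt_id x).mul h2).sub (h1.const_mul ((n : ℝ) + 1))
    refine h.congr_deriv ?_
    rw [show n + 2 - 1 = n + 1 by omega, show n + 1 - 1 = n by omega]
    push_cast
    rw [herm_succ n]
    simp only [id]
    ring

/-- The Hermite function `He_n(x) exp(-x² / 4)`. -/
def hermW (n : ℕ) (x : ℝ) : ℝ := herm n x * Real.exp (-x ^ 2 / 4)

/-- The derivative of `hermW n`. -/
def hermDW (n : ℕ) (x : ℝ) : ℝ :=
  (n * herm (n - 1) x - x / 2 * herm n x) * Real.exp (-x ^ 2 / 4)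

lemma hasDerivAt_exp_neg_sq_div (x : ℝ) :
    HasDerivAt (fun x : ℝ => Real.exp (-x ^ 2 / 4)) (Real.exp (-x ^ 2 / 4) * (-x / 2)) x := by
  have h : HasDerivAt (fun x : ℝ => -x ^ 2 / 4) (-x / 2) x :=
    (((hasDerivAt_pow 2 x).neg).div_const 4).congr_deriv (by simp; ring)
  exact h.exp

lemma hasDerivAt_hermW (n : ℕ) (x : ℝ) : HasDerivAt (hermW n) (hermDW n x) x := by
  refine ((hasDerivAt_herm n x).mul (hasDerivAt_exp_neg_sq_div x)).congr_deriv ?_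
  rw [hermDW]; ring

lemma hasDerivAt_hermDW (n : ℕ) (x : ℝ) :
    HasDerivAt (hermDW n) (-(n + 1 / 2 - x ^ 2 / 4) * hermW n x) x := by
  have h := ((((hasDerivAt_herm (n - 1) x).const_mul (n : ℝ)).sub
    (((hasDerivAt_id x).div_const 2).mul (hasDerivAt_herm n x))).mul
      (hasDerivAt_exp_neg_sq_div x))
  refine h.congr_deriv ?_
  rw [hermW]
  rcases n with _ | n
  · simp; ring
  · have := herm_succ n x
    rw [show n + 1 - 1 = n by omega, this]
    simp only [Pi.sub_apply, Pi.mul_apply, id]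
    rw [this]
    push_cast
    ring

/-- The energy of the oscillator equation `w'' + (n + 1/2 - x²/4) w = 0` along `hermW n`. -/
def hermEnergy (n : ℕ) (x : ℝ) : ℝ :=
  hermDW n x ^ 2 + (n + 1 / 2 - x ^ 2 / 4) * hermW n x ^ 2

lemma hasDerivAt_potential (n : ℕ) (x : ℝ) :
    HasDerivAt (fun x : ℝ => (n + 1 / 2 - x ^ 2 / 4 : ℝ)) (-x / 2) x :=
  (((hasDerivAt_pow 2 x).div_const 4).const_sub _).congr_deriv (by simp; ring)

lemma hasDerivAt_hermEnergy (n : ℕ) (x : ℝ) :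
    HasDerivAt (hermEnergy n) (-(x / 2 * hermW n x ^ 2)) x := by
  refine (((hasDerivAt_hermDW n x).pow 2).add
    ((hasDerivAt_potential n x).mul ((hasDerivAt_hermW n x).pow 2))).congr_deriv ?_
  simp only [Pi.pow_apply]
  push_cast
  ring

lemma hermEnergy_antitoneOn (n : ℕ) : AntitoneOn (hermEnergy n) (Set.Ici 0) := by
  refine antitoneOn_of_hasDerivWithinAt_nonpos (convex_Ici 0)
    (fun x _ => (hasDerivAt_hermEnergy n x).continuousAt.continuousWithinAt)
    (fun x _ => (hasDerivAt_hermEnergy n x).hasDerivWithinAt) (fun x hx => ?_)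
  rw [interior_Ici, Set.mem_Ioi] at hx
  have : 0 ≤ x / 2 * hermW n x ^ 2 := by positivity
  linarith

/-- Confluent Christoffel–Darboux, with the square completed so that the derivative `hermDW`
appears. -/
lemma sum_herm_sq (n : ℕ) (x : ℝ) :
    (∑ k ∈ Finset.range n, herm k x ^ 2 / k.factorial) * n.factorial =
      (n * herm (n - 1) x - x / 2 * herm n x) ^ 2 + (n - x ^ 2 / 4) * herm n x ^ 2 := by
  induction n with
  | zero => simp; ring
  | succ n ih =>
    have hf : (n.factorial : ℝ) ≠ 0 := by positivity
    rw [Finset.sum_range_succ, Nat.factorial_succ, show n + 1 - 1 = n by omega, herm_succ n]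
    push_cast
    rw [add_mul, show (∑ k ∈ Finset.range n, herm k x ^ 2 / k.factorial) *
      ((n + 1) * n.factorial : ℝ) = (n + 1) * ((∑ k ∈ Finset.range n, herm k x ^ 2 / k.factorial) *
      n.factorial) by ring, ih]
    field_simp
    ring

/-- The subtracted term arises because Christoffel–Darboux has `n` where the oscillator potential
has `n + 1/2`. -/
lemma sum_herm_sq_mul_exp (n : ℕ) (x : ℝ) :
    Real.exp (-x ^ 2 / 2) * ∑ k ∈ Finset.range n, herm k x ^ 2 / k.factorial =
      hermEnergy n x / n.factorial - hermW n x ^ 2 / 2 / n.factorial := by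
  have hf : (n.factorial : ℝ) ≠ 0 := by positivity
  rw [div_sub_div_same, eq_div_iff hf, mul_assoc, sum_herm_sq, hermEnergy, hermDW, hermW,
    show Real.exp (-x ^ 2 / 2) = Real.exp (-x ^ 2 / 4) ^ 2 by
      rw [← Real.exp_nat_mul]; congr 1; push_cast; ring]
  ring

lemma mul_sum_herm_mul_herm_zero (n : ℕ) (x : ℝ) :
    x * (∑ k ∈ Finset.range (n + 1), herm k x * herm k 0 / k.factorial) * n.factorial =
      herm (n + 1) x * herm n 0 - herm n x * herm (n + 1) 0 := by
  induction n with
  | zero => simp [herm]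
  | succ n ih =>
    have hf : (n.factorial : ℝ) ≠ 0 := by positivity
    rw [Finset.sum_range_succ, Nat.factorial_succ, herm_succ (n + 1) x, herm_succ (n + 1) 0,
      show n + 1 - 1 = n by omega]
    push_cast
    rw [mul_add, add_mul, show x * (∑ k ∈ Finset.range (n + 1), herm k x * herm k 0 / k.factorial) *
      ((n + 1) * n.factorial : ℝ) = (n + 1) * (x * (∑ k ∈ Finset.range (n + 1),
      herm k x * herm k 0 / k.factorial) * n.factorial) by ring, ih]
    field_simp
    ring

/-! ### Adiabatic invariance of the energy where the potential is positive. -/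

section Comparison

variable {n : ℕ} {X : ℝ}

lemma potential_le {x : ℝ} (hx : x ∈ Set.Icc 0 X) :
    (n + 1 / 2 - X ^ 2 / 4 : ℝ) ≤ n + 1 / 2 - x ^ 2 / 4 := by
  have := pow_le_pow_left₀ hx.1 hx.2 2
  linarith

lemma hermEnergy_nonneg {x : ℝ} (h : (0 : ℝ) ≤ n + 1 / 2 - x ^ 2 / 4) : 0 ≤ hermEnergy n x := by
  unfold hermEnergy; positivity

lemma hermW_sq_le (hX : 0 ≤ X) (hq : (0 : ℝ) < n + 1 / 2 - X ^ 2 / 4) :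
    hermW n X ^ 2 ≤ hermEnergy n 0 / (n + 1 / 2 - X ^ 2 / 4) := by
  rw [le_div_iff₀ hq]
  refine le_trans ?_ (hermEnergy_antitoneOn n Set.self_mem_Ici hX hX)
  rw [hermEnergy]
  linarith [sq_nonneg (hermDW n X)]

/-- AM–GM gives `2 √q |w w'| ≤ w'² + q w²`, and the energy never exceeds its value at `0`. -/
lemma abs_hermW_mul_hermDW_le {x : ℝ} (hq : (0 : ℝ) < n + 1 / 2 - X ^ 2 / 4)
    (hx : x ∈ Set.Icc 0 X) :
    |hermW n x * hermDW n x| ≤ hermEnergy n 0 / √(n + 1 / 2 - X ^ 2 / 4) / 2 := by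
  set q : ℝ := n + 1 / 2 - X ^ 2 / 4
  have hs : 0 < √q := Real.sqrt_pos.2 hq
  have hle := potential_le (n := n) hx
  have hE := hermEnergy_antitoneOn n Set.self_mem_Ici hx.1 hx.1
  rw [div_div, le_div_iff₀ (by positivity)]
  refine le_trans ?_ hE
  have h2 := mul_le_mul_of_nonneg_right hle (sq_nonneg (hermW n x))
  have h3 : √q ^ 2 = q := Real.sq_sqrt hq.le
  rw [hermEnergy, abs_mul]
  have h4 := sq_nonneg (|hermDW n x| - √q * |hermW n x|)
  have h5 := sq_abs (hermDW n x)
  have h6 := sq_abs (hermW n x)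
  have h7 : (√q * |hermW n x|) ^ 2 = q * hermW n x ^ 2 := by rw [mul_pow, h3, h6]
  change q * _ ≤ _ at h2
  nlinarith

/-- Energy of the Liouville-Green transform, up to a first order correction. -/
def liouvilleEnergy (n : ℕ) (x : ℝ) : ℝ :=
  hermEnergy n x / √(n + 1 / 2 - x ^ 2 / 4) +
    -x / (4 * √(n + 1 / 2 - x ^ 2 / 4) ^ 3) * (hermW n x * hermDW n x)

lemma hasDerivAt_sqrt_potential {x : ℝ} (hq : (0 : ℝ) < n + 1 / 2 - x ^ 2 / 4) :
    HasDerivAt (fun x : ℝ => √(n + 1 / 2 - x ^ 2 / 4 : ℝ))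
      (-x / (4 * √(n + 1 / 2 - x ^ 2 / 4))) x := by
  refine ((hasDerivAt_potential n x).sqrt hq.ne').congr_deriv ?_
  have hs : 0 < √(n + 1 / 2 - x ^ 2 / 4 : ℝ) := Real.sqrt_pos.2 hq
  field_simp
  ring

lemma hasDerivAt_correction {x : ℝ} (hq : (0 : ℝ) < n + 1 / 2 - x ^ 2 / 4) :
    HasDerivAt (fun x : ℝ => -x / (4 * √(n + 1 / 2 - x ^ 2 / 4 : ℝ) ^ 3))
      (-(1 / (4 * √(n + 1 / 2 - x ^ 2 / 4) ^ 3) +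
        3 * x ^ 2 / (16 * √(n + 1 / 2 - x ^ 2 / 4) ^ 5))) x := by
  have hs : 0 < √(n + 1 / 2 - x ^ 2 / 4 : ℝ) := Real.sqrt_pos.2 hq
  refine ((hasDerivAt_id x).neg.div (((hasDerivAt_sqrt_potential hq).pow 3).const_mul 4)
    (by simp only [Pi.pow_apply]; positivity)).congr_deriv ?_
  simp only [Pi.pow_apply, Pi.neg_apply, id]
  push_cast
  field_simp
  ring

/-- Since `(w w')' = w'² - q w²`, the derivative of `E / √q` is `-R (w w')'` with `R = q' / (2
q^(3/2))`. The correction `R w w'` absorbs it, leaving only `R' w w'`. -/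
lemma hasDerivAt_liouvilleEnergy {x : ℝ} (hq : (0 : ℝ) < n + 1 / 2 - x ^ 2 / 4) :
    HasDerivAt (liouvilleEnergy n)
      (-(1 / (4 * √(n + 1 / 2 - x ^ 2 / 4) ^ 3) +
        3 * x ^ 2 / (16 * √(n + 1 / 2 - x ^ 2 / 4) ^ 5)) * (hermW n x * hermDW n x)) x := by
  have hs : 0 < √(n + 1 / 2 - x ^ 2 / 4 : ℝ) := Real.sqrt_pos.2 hq
  refine (((hasDerivAt_hermEnergy n x).div (hasDerivAt_sqrt_potential hq) hs.ne').add
    ((hasDerivAt_correction hq).mul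
      ((hasDerivAt_hermW n x).mul (hasDerivAt_hermDW n x)))).congr_deriv ?_
  have h3 : √(n + 1 / 2 - x ^ 2 / 4 : ℝ) ^ 2 = n + 1 / 2 - x ^ 2 / 4 := Real.sq_sqrt hq.le
  simp only [Pi.mul_apply, hermEnergy]
  rw [← h3, Real.sqrt_sq hs.le]
  field_simp
  ring

/-- The energy follows the square root of the potential. -/
lemma abs_hermEnergy_sub_le (hX : 0 ≤ X) (hq : (0 : ℝ) < n + 1 / 2 - X ^ 2 / 4) :
    |hermEnergy n X - hermEnergy n 0 * (√(n + 1 / 2 - X ^ 2 / 4) / √(n + 1 / 2))| ≤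
      X / (4 * √(n + 1 / 2 - X ^ 2 / 4) ^ 3) * hermEnergy n 0 := by
  set M := hermEnergy n 0 / √(n + 1 / 2 - X ^ 2 / 4) with hM
  set R : ℝ → ℝ := fun x => -x / (4 * √(n + 1 / 2 - x ^ 2 / 4 : ℝ) ^ 3) with hR
  have hqx : ∀ x ∈ Set.Icc 0 X, (0 : ℝ) < n + 1 / 2 - x ^ 2 / 4 :=
    fun x hx => hq.trans_le (potential_le hx)
  -- Adding `c R` with `c = ±M/2` makes `w w' + c` of constant sign, and `R' ≤ 0`; monotonicity then
  -- replaces integration of the error.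
  have hD : ∀ c : ℝ, ∀ x ∈ Set.Icc 0 X, HasDerivAt (fun x => liouvilleEnergy n x + c * R x)
      (-(1 / (4 * √(n + 1 / 2 - x ^ 2 / 4) ^ 3) +
        3 * x ^ 2 / (16 * √(n + 1 / 2 - x ^ 2 / 4) ^ 5)) * (hermW n x * hermDW n x + c)) x := by
    intro c x hx
    refine ((hasDerivAt_liouvilleEnergy (hqx x hx)).add
      ((hasDerivAt_correction (hqx x hx)).const_mul c)).congr_deriv ?_
    ring
  have hbound : ∀ x ∈ Set.Icc 0 X, |hermW n x * hermDW n x| ≤ M / 2 :=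
    fun x hx => abs_hermW_mul_hermDW_le hq hx
  have hpos : ∀ x : ℝ, 0 ≤ 1 / (4 * √(n + 1 / 2 - x ^ 2 / 4 : ℝ) ^ 3) +
        3 * x ^ 2 / (16 * √(n + 1 / 2 - x ^ 2 / 4) ^ 5) := fun x => by positivity
  have h0 : (0 : ℝ) ∈ Set.Icc 0 X := ⟨le_rfl, hX⟩
  have hXm : X ∈ Set.Icc 0 X := ⟨hX, le_rfl⟩
  have hR0 : R 0 = 0 := by simp [hR]
  have hG0 : liouvilleEnergy n 0 = hermEnergy n 0 / √(n + 1 / 2) := by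
    simp [liouvilleEnergy]
  have up : liouvilleEnergy n X + M / 2 * R X ≤ hermEnergy n 0 / √(n + 1 / 2) := by
    have : AntitoneOn (fun x => liouvilleEnergy n x + M / 2 * R x) (Set.Icc 0 X) :=
      antitoneOn_of_hasDerivWithinAt_nonpos (convex_Icc 0 X)
        (fun x hx => (hD _ x hx).continuousAt.continuousWithinAt)
        (fun x hx => (hD _ x (interior_subset hx)).hasDerivWithinAt) (fun x hx => by
          have := (abs_le.1 (hbound x (interior_subset hx))).1
          exact mul_nonpos_of_nonpos_of_nonneg (by linarith [hpos x]) (by linarith))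
    have := this h0 hXm hX
    simpa only [hR0, mul_zero, add_zero, hG0] using this
  have lo : hermEnergy n 0 / √(n + 1 / 2) ≤ liouvilleEnergy n X + -(M / 2) * R X := by
    have : MonotoneOn (fun x => liouvilleEnergy n x + -(M / 2) * R x) (Set.Icc 0 X) :=
      monotoneOn_of_hasDerivWithinAt_nonneg (convex_Icc 0 X)
        (fun x hx => (hD _ x hx).continuousAt.continuousWithinAt)
        (fun x hx => (hD _ x (interior_subset hx)).hasDerivWithinAt) (fun x hx => by
          have := (abs_le.1 (hbound x (interior_subset hx))).2
          exact mul_nonneg_of_nonpos_of_nonpos (by linarith [hpos x]) (by linarith))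
    have := this h0 hXm hX
    simpa only [hR0, mul_zero, add_zero, hG0] using this
  have hs : 0 < √(n + 1 / 2 - X ^ 2 / 4 : ℝ) := Real.sqrt_pos.2 hq
  set s := √(n + 1 / 2 - X ^ 2 / 4 : ℝ)
  have hRX : R X = -(X / (4 * s ^ 3)) := by simp [hR, s, neg_div]
  set ρ := X / (4 * s ^ 3)
  have hρ : 0 ≤ ρ := by positivity
  have hLX : liouvilleEnergy n X = hermEnergy n X / s + -ρ * (hermW n X * hermDW n X) := by
    rw [liouvilleEnergy, ← hRX]
  rw [hLX, hRX] at up lo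
  have hb := abs_le.1 (hbound X hXm)
  have h1 := mul_le_mul_of_nonneg_left hb.1 hρ
  have h2 := mul_le_mul_of_nonneg_left hb.2 hρ
  -- Half of `ρ * M` bounds the variation of `liouvilleEnergy`, the other half its correction term
  -- at `X`; at `0` the correction vanishes.
  have key : |hermEnergy n X / s - hermEnergy n 0 / √(n + 1 / 2)| ≤ ρ * M := by
    rw [abs_le]; constructor <;> linarith
  have := mul_le_mul_of_nonneg_left key hs.le
  rw [← abs_of_pos hs, ← abs_mul, abs_of_pos hs] at this
  calc _ = |s * (hermEnergy n X / s - hermEnergy n 0 / √(n + 1 / 2))| := by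
        congr 1; field_simp
    _ ≤ _ := this
    _ = _ := by rw [hM]; field_simp

end Comparison

/-! ### The energy at the origin, from Wallis' product. -/

lemma herm_zero_odd (m : ℕ) : herm (2 * m + 1) 0 = 0 := by
  induction m with
  | zero => rfl
  | succ m ih =>
    rw [show 2 * (m + 1) + 1 = (2 * m + 1) + 2 by ring, herm, ih]; simp

lemma herm_zero_even (m : ℕ) :
    herm (2 * m) 0 * (2 ^ m * m.factorial) = (-1) ^ m * (2 * m).factorial := by
  induction m with
  | zero => simp [herm]
  | succ m ih =>
    rw [show 2 * (m + 1) = 2 * m + 2 by ring, herm, Nat.factorial_succ, Nat.factorial_succ,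
      Nat.factorial_succ]
    push_cast
    linear_combination (-(2 * (m : ℝ) + 1) * 2 * (m + 1)) * ih

lemma herm_zero_sq_div_factorial (m : ℕ) :
    herm (2 * m) 0 ^ 2 / (2 * m).factorial = 1 / (√(Real.Wallis.W m) * √(2 * m + 1)) := by
  have hW := Real.Wallis.W_pos m
  have h := herm_zero_even m
  have hf : (0 : ℝ) < (2 * m).factorial := by positivity
  have hm : (0 : ℝ) < m.factorial := by positivity
  rw [← Real.sqrt_mul hW.le, ← sq_eq_sq₀ (by positivity) (by positivity), div_pow 1,
    Real.sq_sqrt (by positivity), Real.Wallis.W_eq_factorial_ratio]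
  have h4 : herm (2 * m) 0 ^ 4 * (2 ^ (4 * m) * m.factorial ^ 4) = (2 * m).factorial ^ 4 := by
    have := congrArg (· ^ 4) h
    simp only [mul_pow, ← pow_mul] at this
    rw [mul_comm m 4, Even.neg_one_pow ⟨2 * m, by ring⟩, one_mul] at this
    exact this
  have h1 : (0 : ℝ) < 2 * m + 1 := by positivity
  field_simp
  linear_combination h4

lemma hermEnergy_zero (n : ℕ) :
    hermEnergy n 0 = (n * herm (n - 1) 0) ^ 2 + (n + 1 / 2) * herm n 0 ^ 2 := by
  simp [hermEnergy, hermDW, hermW]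

lemma hermEnergy_zero_div_bounds {n : ℕ} (hn : 0 < n) :
    1 / √(Real.Wallis.W (n / 2)) ≤ hermEnergy n 0 / (n.factorial * √n) ∧
    hermEnergy n 0 / (n.factorial * √n) ≤ (1 + 1 / (2 * n)) * (1 / √(Real.Wallis.W (n / 2))) := by
  have hW := Real.sqrt_pos.2 (Real.Wallis.W_pos (n / 2))
  have hn' : (0 : ℝ) < n := by exact_mod_cast hn
  rcases Nat.even_or_odd' n with ⟨m, rfl | rfl⟩
  · have hm : 2 * m / 2 = m := by omega
    have hz : ((2 * m : ℕ) * herm (2 * m - 1) 0) = 0 := by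
      rcases m with _ | m
      · simp
      · rw [show 2 * (m + 1) - 1 = 2 * m + 1 by omega, herm_zero_odd, mul_zero]
    rw [hm] at hW ⊢
    have e : hermEnergy (2 * m) 0 / ((2 * m).factorial * √(2 * m : ℕ)) =
        ((2 * m : ℕ) + 1 / 2) / (√(2 * m : ℕ) * √(2 * m + 1)) * (1 / √(Real.Wallis.W m)) := by
      have h := herm_zero_sq_div_factorial m
      rw [hermEnergy_zero, hz]
      have hf : (0 : ℝ) < (2 * m).factorial := by positivity
      rw [show (0 ^ 2 + ((2 * m : ℕ) + 1 / 2) * herm (2 * m) 0 ^ 2) /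
        ((2 * m).factorial * √(2 * m : ℕ)) = ((2 * m : ℕ) + 1 / 2) / √(2 * m : ℕ) *
          (herm (2 * m) 0 ^ 2 / (2 * m).factorial) by field_simp; ring, h]
      field_simp
    rw [e]
    push_cast at hn' ⊢
    set t : ℝ := 2 * m
    -- Both bounds come from `t² ≤ t(t + 1) ≤ (t + 1/2)²`.
    have hs : 0 < √t * √(t + 1) := by positivity
    have hs2 : (√t * √(t + 1)) ^ 2 = t * (t + 1) := by
      rw [mul_pow, Real.sq_sqrt hn'.le, Real.sq_sqrt (by positivity)]
    constructor
    · refine le_mul_of_one_le_left (by positivity) ?_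
      rw [one_le_div hs]
      exact abs_le_of_sq_le_sq' (by rw [hs2]; nlinarith) (by positivity) |>.2
    · refine mul_le_mul_of_nonneg_right ?_ (by positivity)
      rw [div_le_iff₀ hs]
      have h1 : t ≤ √t * √(t + 1) :=
        abs_le_of_sq_le_sq' (by rw [hs2]; nlinarith) hs.le |>.2
      calc t + 1 / 2 = (1 + 1 / (2 * t)) * t := by field_simp
        _ ≤ _ := mul_le_mul_of_nonneg_left h1 (by positivity)
  · have hm : (2 * m + 1) / 2 = m := by omega
    rw [hm] at hW ⊢
    have e : hermEnergy (2 * m + 1) 0 / ((2 * m + 1).factorial * √(2 * m + 1 : ℕ)) =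
        1 / √(Real.Wallis.W m) := by
      have h := herm_zero_sq_div_factorial m
      rw [hermEnergy_zero, herm_zero_odd, show 2 * m + 1 - 1 = 2 * m by omega, Nat.factorial_succ]
      have hf : (0 : ℝ) < (2 * m).factorial := by positivity
      push_cast
      have h1 : (0 : ℝ) < 2 * m + 1 := by positivity
      rw [show (((2 * m + 1) * herm (2 * m) 0) ^ 2 + (2 * m + 1 + 1 / 2) * 0 ^ 2 : ℝ) /
        ((2 * m + 1) * (2 * m).factorial * √(2 * m + 1)) = (2 * m + 1) / √(2 * m + 1) *
          (herm (2 * m) 0 ^ 2 / (2 * m).factorial) by field_simp; ring, h]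
      have h2 := Real.mul_self_sqrt h1.le
      field_simp
      nlinarith
    rw [e]
    refine ⟨le_rfl, le_mul_of_one_le_left (by positivity) ?_⟩
    have : (0 : ℝ) ≤ 1 / (2 * (2 * m + 1 : ℕ)) := by positivity
    linarith

lemma tendsto_hermEnergy_zero :
    Tendsto (fun n : ℕ => hermEnergy n 0 / (n.factorial * √n)) atTop (𝓝 (√(2 / Real.pi))) := by
  have hW : Tendsto (fun n : ℕ => 1 / √(Real.Wallis.W (n / 2))) atTop (𝓝 (√(2 / Real.pi))) := by
    have hd : Tendsto (fun n : ℕ => n / 2) atTop atTop :=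
      Nat.tendsto_div_const_atTop (by norm_num)
    have h := (Real.Wallis.tendsto_W_nhds_pi_div_two.comp hd).sqrt
    have hp : √(Real.pi / 2) ≠ 0 := by positivity
    have h2 : √(2 / Real.pi) = 1 / √(Real.pi / 2) := by
      rw [← Real.sqrt_one, ← Real.sqrt_div zero_le_one, one_div_div]
    rw [h2]
    exact tendsto_const_nhds.div h hp
  have h1 : Tendsto (fun n : ℕ => (1 + 1 / (2 * n) : ℝ) * (1 / √(Real.Wallis.W (n / 2)))) atTop
      (𝓝 (√(2 / Real.pi))) := by
    have h3 : Tendsto (fun n : ℕ => (1 + 1 / (2 * n) : ℝ)) atTop (𝓝 1) := by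
      have h4 := (tendsto_one_div_atTop_nhds_zero_nat (𝕜 := ℝ)).const_mul (1 / 2)
      have h5 := h4.const_add 1
      simp only [mul_zero, add_zero] at h5
      refine h5.congr fun n => ?_
      rw [one_div_mul_one_div]
    simpa using h3.mul hW
  refine tendsto_of_tendsto_of_tendsto_of_le_of_le' hW h1 ?_ ?_
  · filter_upwards [eventually_gt_atTop 0] with n hn using (hermEnergy_zero_div_bounds hn).1
  · filter_upwards [eventually_gt_atTop 0] with n hn using (hermEnergy_zero_div_bounds hn).2

end QuaternionField
end

/-! ### The radial density in terms of Hermite kernels. -/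

noncomputable section

namespace QuaternionField

open Polynomial

/-- The imaginary unit in the direction of `x`. -/
def unitPure (x : Space) : ℍ[ℝ] := ‖x‖⁻¹ • toPure x

section

variable {x : Space}

lemma unitPure_mul_self (hx : x ≠ 0) : unitPure x * unitPure x = -1 := by
  have h : ‖x‖ ≠ 0 := norm_ne_zero_iff.2 hx
  rw [unitPure, smul_mul_smul_comm, toPure_mul_self, Quaternion.smul_coe,
    show ‖x‖⁻¹ * ‖x‖⁻¹ * -‖x‖ ^ 2 = -1 by field_simp]
  simp

lemma toPure_eq_smul_unitPure (hx : x ≠ 0) : toPure x = ‖x‖ • unitPure x := by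
  rw [unitPure, smul_inv_smul₀ (norm_ne_zero_iff.2 hx)]

lemma norm_unitPure (hx : x ≠ 0) : ‖unitPure x‖ = 1 := by
  rw [unitPure, norm_smul, norm_toPure, norm_inv, norm_norm,
    inv_mul_cancel₀ (norm_ne_zero_iff.2 hx)]

/-- Since `unitPure x` squares to `-1`, real polynomials at `toPure x` behave as complex polynomials
at `ir`, where the imaginary Hermite recursion becomes the ordinary one. -/
lemma aeval_imagHermite (hx : x ≠ 0) (n : ℕ) :
    aeval (toPure x) (imagHermite n) = herm n ‖x‖ • unitPure x ^ n := by
  induction n using Nat.twoStepInduction with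
  | zero => simp [imagHermite, herm]
  | one => simp [imagHermite, herm, toPure_eq_smul_unitPure hx]
  | more n h1 h2 =>
    have hu : unitPure x * (unitPure x * unitPure x ^ n) = -unitPure x ^ n := by
      rw [← mul_assoc, unitPure_mul_self hx, neg_one_mul]
    rw [imagHermite_succ_succ, map_add, map_mul, map_smul, aeval_X, h1, h2, herm,
      toPure_eq_smul_unitPure hx, smul_mul_smul_comm, pow_succ', pow_succ', pow_succ', hu]
    module

lemma imagHermite_eval_zero_smul (hx : x ≠ 0) (n : ℕ) :
    (imagHermite n).eval 0 • unitPure x ^ n = ((herm n 0 : ℝ) : ℍ[ℝ]) := by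
  induction n using Nat.twoStepInduction with
  | zero => simp [imagHermite, herm]
  | one => simp [imagHermite, herm]
  | more n h1 h2 =>
    rw [imagHermite_succ_succ, eval_add, eval_mul, eval_X, zero_mul, zero_add, eval_smul,
      smul_eq_mul, pow_add, sq, unitPure_mul_self hx, mul_smul, mul_neg_one, smul_neg, h1, herm]
    simp only [zero_mul, zero_sub, Quaternion.coe_neg, Quaternion.coe_mul, smul_neg,
      Quaternion.coe_mul_eq_smul]

lemma imagHermite_eval_zero_sq (n : ℕ) : (imagHermite n).eval 0 ^ 2 = herm n 0 ^ 2 := by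
  have hx : EuclideanSpace.single (0 : Fin 3) (1 : ℝ) ≠ 0 := by simp
  have h := congrArg norm (imagHermite_eval_zero_smul hx n)
  rw [norm_smul, norm_pow, norm_unitPure hx, one_pow, mul_one, Quaternion.norm_coe] at h
  rw [← sq_abs, ← Real.norm_eq_abs, h, Real.norm_eq_abs, sq_abs]

end

/-- The Christoffel-Darboux kernel of the Hermite polynomials at `(r, 0)`. -/
def hermKernelZero (n : ℕ) (r : ℝ) : ℝ :=
  ∑ k ∈ Finset.range n, herm k r * herm k 0 / k.factorial

lemma evalKernel_eval_zero_eq (n : ℕ) : (evalKernel n).eval 0 = hermKernelZero n 0 := by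
  rw [evalKernel_eval_zero, hermKernelZero]
  exact Finset.sum_congr rfl fun k _ => by rw [imagHermite_eval_zero_sq, sq]

lemma one_le_hermKernelZero (n : ℕ) : 1 ≤ hermKernelZero (n + 1) 0 := by
  rw [← evalKernel_eval_zero_eq]
  exact one_le_evalKernel_eval_zero n

lemma aeval_evalKernel {x : Space} (hx : x ≠ 0) (n : ℕ) :
    aeval (toPure x) (evalKernel n) = ((hermKernelZero n ‖x‖ : ℝ) : ℍ[ℝ]) := by
  rw [evalKernel, map_sum, hermKernelZero, ← Quaternion.algebraMap_def, map_sum]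
  refine Finset.sum_congr rfl fun k _ => ?_
  rw [map_smul, aeval_imagHermite hx, Quaternion.algebraMap_def, smul_comm, div_eq_inv_mul,
    mul_smul, imagHermite_eval_zero_smul hx, Quaternion.smul_coe, Quaternion.smul_coe]
  congr 1
  ring

/-- The diagonal Christoffel-Darboux kernel of the Hermite polynomials, with the contribution of
the evaluation at `0` removed. -/
lemma norm_sq_mul_kernel_self_re {x : Space} (hx : x ≠ 0) (n : ℕ) :
    ‖x‖ ^ 2 * (kernel n x x).re =
      ∑ k ∈ Finset.range (n + 1), herm k ‖x‖ ^ 2 / k.factorial -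
        hermKernelZero (n + 1) ‖x‖ ^ 2 / hermKernelZero (n + 1) 0 := by
  have hp : ∀ k : ℕ, ‖x‖ ^ 2 * ‖aeval (toPure x) (christoffelPoly k)‖ ^ 2 =
      (herm (k + 1) ‖x‖ - herm (k + 1) 0 / hermKernelZero (k + 1) 0 *
        hermKernelZero (k + 1) ‖x‖) ^ 2 := by
    intro k
    have h : toPure x * aeval (toPure x) (christoffelPoly k) = herm (k + 1) ‖x‖ •
        unitPure x ^ (k + 1) - (((imagHermite (k + 1)).eval 0 / hermKernelZero (k + 1) 0 *
          hermKernelZero (k + 1) ‖x‖ : ℝ) : ℍ[ℝ]) := by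
      have e := congrArg (aeval (toPure x)) (X_mul_christoffelPoly k)
      rw [map_mul, aeval_X, map_sub, map_smul, aeval_imagHermite hx, aeval_evalKernel hx,
        evalKernel_eval_zero_eq, Quaternion.smul_coe] at e
      exact e
    have hu : ‖unitPure x ^ (k + 1)‖ = 1 := by rw [norm_pow, norm_unitPure hx, one_pow]
    -- The real part of the unit power, weighted by the value at `0`, is all that the cross term of
    -- the squared norm needs.
    have h0 := congrArg (fun q : ℍ[ℝ] => q.re) (imagHermite_eval_zero_smul hx (k + 1))
    simp only [Quaternion.re_smul, Quaternion.re_coe, smul_eq_mul] at h0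
    rw [← norm_toPure x, ← mul_pow, ← norm_mul, h, norm_toPure, sq,
      ← Quaternion.normSq_eq_norm_mul_self, sub_eq_add_neg, ← Quaternion.coe_neg,
      Quaternion.normSq_add, Quaternion.normSq_smul,
      Quaternion.normSq_eq_norm_mul_self (unitPure x ^ (k + 1)), hu, Quaternion.normSq_coe,
      Quaternion.star_coe, Quaternion.mul_coe_eq_smul, Quaternion.re_smul, Quaternion.re_smul]
    have h2 := imagHermite_eval_zero_sq (k + 1)
    simp only [smul_eq_mul]
    linear_combination (-2 * herm (k + 1) ‖x‖ * hermKernelZero (k + 1) ‖x‖ /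
      hermKernelZero (k + 1) 0) * h0 + (hermKernelZero (k + 1) ‖x‖ /
      hermKernelZero (k + 1) 0) ^ 2 * h2
  rw [kernel_self_re, Finset.mul_sum]
  induction n with
  | zero => simp [herm, hermKernelZero]
  | succ n ih =>
    have hκ : 0 < hermKernelZero (n + 1) 0 := by linarith [one_le_hermKernelZero n]
    have hf : (0 : ℝ) < (n + 1).factorial := by positivity
    have hs : ∀ r, hermKernelZero (n + 1 + 1) r = hermKernelZero (n + 1) r +
        herm (n + 1) r * herm (n + 1) 0 / (n + 1).factorial :=
      fun r => Finset.sum_range_succ _ _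
    rw [Finset.sum_range_succ, ih, Finset.sum_range_succ _ (n + 1), hs, hs, mul_div_assoc', hp,
      pureForm_christoffelPoly_self, evalKernel_eval_zero_eq, imagHermite_eval_zero_sq]
    -- What remains is the rank-one update `(a - bT/κ)² / (g + b²/κ) = a²/g + T²/κ - (T + ab/g)² /
    -- (κ + b²/g)`.
    clear ih hs hp
    generalize hermKernelZero (n + 1) 0 = κ at hκ ⊢
    generalize hermKernelZero (n + 1) ‖x‖ = T
    generalize herm (n + 1) 0 = b
    generalize herm (n + 1) ‖x‖ = a
    generalize ((n + 1).factorial : ℝ) = g at hf ⊢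
    have h1 : 0 < g + b ^ 2 / κ := by positivity
    rw [← sq b]
    have h2 : 0 < κ + b ^ 2 / g := by positivity
    have h3 : 0 < κ * g + b ^ 2 := by positivity
    field_simp
    ring

lemma toSphere_real_univ :
    (Measure.toSphere (volume : Measure Space)).real Set.univ = 4 * Real.pi := by
  rw [Measure.toSphere_real_apply_univ, Measure.real, EuclideanSpace.volume_ball_fin_three,
    finrank_euclideanSpace, Fintype.card_fin, ENNReal.ofReal_one, one_pow, one_mul,
    ENNReal.toReal_ofReal (by positivity)]
  push_cast; ring

/-- The area `4πr²` cancels the `r²` relating the kernel to Hermite sums, and `4π (2π)^(-3/2) = 2 /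
√(2π)`. -/
lemma radialDensity_eq (n : ℕ) {r : ℝ} (hr : 0 < r) :
    radialDensity n r = 2 / √(2 * Real.pi) * (Real.exp (-r ^ 2 / 2) *
      ∑ k ∈ Finset.range (n + 1), herm k r ^ 2 / k.factorial -
        Real.exp (-r ^ 2 / 2) * hermKernelZero (n + 1) r ^ 2 / hermKernelZero (n + 1) 0) := by
  have hu : ∀ u : Metric.sphere (0 : Space) 1, ‖r • (u : Space)‖ = r := fun u => by
    rw [norm_smul, norm_eq_of_mem_sphere, mul_one, Real.norm_of_nonneg hr.le]
  rw [radialDensity, sphereMeasure, integral_smul_measure, integral_map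
    (by fun_prop) (continuous_fieldDensity n).aestronglyMeasurable]
  have hF : ∀ u : Metric.sphere (0 : Space) 1, fieldDensity n (r • (u : Space)) =
      (∑ k ∈ Finset.range (n + 1), herm k r ^ 2 / k.factorial -
        hermKernelZero (n + 1) r ^ 2 / hermKernelZero (n + 1) 0) / r ^ 2 *
        ((2 * Real.pi) ^ (-(3 / 2) : ℝ) * Real.exp (-r ^ 2 / 2)) := fun u => by
    have hne : r • (u : Space) ≠ 0 := norm_ne_zero_iff.1 (by rw [hu]; exact hr.ne')
    have h := norm_sq_mul_kernel_self_re hne n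
    rw [hu] at h
    rw [fieldDensity, gaussDensity, hu, ← h, mul_div_cancel_left₀ _ (by positivity)]
  simp_rw [hF]
  rw [integral_const, toSphere_real_univ, ENNReal.toReal_ofReal (by positivity), smul_eq_mul,
    smul_eq_mul, Real.rpow_neg (by positivity), show (3 / 2 : ℝ) = 1 + 1 / 2 by norm_num,
    Real.rpow_add (by positivity), Real.rpow_one, ← Real.sqrt_eq_rpow]
  have hp := Real.pi_pos
  field_simp
  ring

lemma radialDensity_nonneg (n : ℕ) (r : ℝ) : 0 ≤ radialDensity n r :=
  integral_nonneg fun x => mul_nonneg (kernel_self_re_nonneg n x) (gaussDensity_pos x).le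

end QuaternionField
end

/-! ### Scaling limits inside and outside the semicircle. -/

noncomputable section

namespace QuaternionField

lemma hermEnergy_zero_nonneg (n : ℕ) : 0 ≤ hermEnergy n 0 :=
  hermEnergy_nonneg (by norm_num; positivity)

/-- The Hermite order is `n + 1` while the scaling uses `√n`; the mismatch `√(1 + 1/n)` tends to
`1`. -/
lemma tendsto_hermEnergy_zero_succ :
    Tendsto (fun n : ℕ => hermEnergy (n + 1) 0 / ((n + 1).factorial * √n)) atTop
      (𝓝 (√(2 / Real.pi))) := by
  have h := (tendsto_add_atTop_iff_nat 1).2 tendsto_hermEnergy_zero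
  have h2 : Tendsto (fun n : ℕ => √(1 + 1 / (n : ℝ))) atTop (𝓝 1) := by
    have := ((tendsto_one_div_atTop_nhds_zero_nat (𝕜 := ℝ)).const_add 1).sqrt
    simpa using this
  have h3 := h.mul h2
  rw [mul_one] at h3
  refine h3.congr' ?_
  filter_upwards [eventually_gt_atTop 0] with n hn
  have hn' : (0 : ℝ) < n := by exact_mod_cast hn
  rw [show 1 + 1 / (n : ℝ) = ((n + 1 : ℕ) : ℝ) / n by push_cast; field_simp,
    Real.sqrt_div (by positivity)]
  have : 0 < √((n + 1 : ℕ) : ℝ) := by positivity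
  field_simp

section

variable {s : ℝ}

lemma potential_scaled (n k : ℕ) (s : ℝ) :
    ((n + k : ℕ) + 1 / 2 - (2 * √n * s) ^ 2 / 4 : ℝ) = n * (1 - s ^ 2) + (k + 1 / 2) := by
  rw [mul_pow, mul_pow, Real.sq_sqrt n.cast_nonneg]
  push_cast; ring

lemma potential_scaled_pos (n k : ℕ) (h0 : 0 < s) (h1 : s < 1) :
    0 < ((n + k : ℕ) + 1 / 2 - (2 * √n * s) ^ 2 / 4 : ℝ) := by
  rw [potential_scaled]
  have : 0 < 1 - s ^ 2 := by nlinarith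
  positivity

lemma tendsto_sqrt_potential_ratio (h0 : 0 < s) (h1 : s < 1) :
    Tendsto (fun n : ℕ => √((n + 1 : ℕ) + 1 / 2 - (2 * √n * s) ^ 2 / 4) /
      √((n + 1 : ℕ) + 1 / 2)) atTop (𝓝 (√(1 - s ^ 2))) := by
  have hinv := tendsto_one_div_atTop_nhds_zero_nat (𝕜 := ℝ)
  have ha : Tendsto (fun n : ℕ => ((1 - s ^ 2) + 3 / 2 * (1 / (n : ℝ))) /
      (1 + 3 / 2 * (1 / (n : ℝ)))) atTop (𝓝 (((1 - s ^ 2) + 3 / 2 * 0) / (1 + 3 / 2 * 0))) :=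
    ((hinv.const_mul _).const_add _).div ((hinv.const_mul _).const_add _) (by norm_num)
  rw [mul_zero, add_zero, add_zero, div_one] at ha
  refine ha.sqrt.congr' ?_
  filter_upwards [eventually_gt_atTop 0] with n hn
  have hn' : (0 : ℝ) < n := by exact_mod_cast hn
  rw [← Real.sqrt_div (potential_scaled_pos n 1 h0 h1).le, potential_scaled]
  congr 1
  push_cast
  field_simp
  ring

lemma tendsto_hermEnergy_scaled (h0 : 0 < s) (h1 : s < 1) :
    Tendsto (fun n : ℕ => hermEnergy (n + 1) (2 * √n * s) / ((n + 1).factorial * √n)) atTop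
      (𝓝 (√(2 / Real.pi) * √(1 - s ^ 2))) := by
  have hc : 0 < 1 - s ^ 2 := by nlinarith
  have hmain := tendsto_hermEnergy_zero_succ.mul (tendsto_sqrt_potential_ratio h0 h1)
  have herr : Tendsto (fun n : ℕ => s / (2 * √(1 - s ^ 2) ^ 3) * (1 / (n : ℝ)) *
      (hermEnergy (n + 1) 0 / ((n + 1).factorial * √n))) atTop (𝓝 0) := by
    have := ((tendsto_one_div_atTop_nhds_zero_nat (𝕜 := ℝ)).const_mul
      (s / (2 * √(1 - s ^ 2) ^ 3))).mul tendsto_hermEnergy_zero_succ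
    simpa using this
  refine tendsto_of_tendsto_of_dist hmain (squeeze_zero' (.of_forall fun _ => dist_nonneg) ?_ herr)
  filter_upwards [eventually_gt_atTop 0] with n hn
  have hn' : (0 : ℝ) < n := by exact_mod_cast hn
  have hq := potential_scaled_pos n 1 h0 h1
  have hX : 0 ≤ 2 * √n * s := by positivity
  have h := abs_hermEnergy_sub_le hX hq
  have hd : (0 : ℝ) < (n + 1).factorial * √n := by positivity
  have hE := hermEnergy_zero_nonneg (n + 1)
  have hsq : √n * √(1 - s ^ 2) ≤ √((n + 1 : ℕ) + 1 / 2 - (2 * √n * s) ^ 2 / 4) := by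
    rw [← Real.sqrt_mul hn'.le, potential_scaled]
    exact Real.sqrt_le_sqrt (by norm_num)
  rw [dist_comm, Real.dist_eq, div_mul_eq_mul_div, div_sub_div_same, abs_div, abs_of_pos hd,
    mul_div_assoc' _ (hermEnergy (n + 1) 0), div_le_div_iff_of_pos_right hd]
  refine h.trans (mul_le_mul_of_nonneg_right ?_ hE)
  calc 2 * √n * s / (4 * √((n + 1 : ℕ) + 1 / 2 - (2 * √n * s) ^ 2 / 4) ^ 3)
      ≤ 2 * √n * s / (4 * (√n * √(1 - s ^ 2)) ^ 3) := by gcongr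
    _ = s / (2 * √(1 - s ^ 2) ^ 3) * (1 / (n : ℝ)) := by
        have hs := Real.sq_sqrt hn'.le
        nth_rewrite 3 [← hs]
        field_simp
        ring

lemma tendsto_hermW_scaled (h0 : 0 < s) (h1 : s < 1) :
    Tendsto (fun n : ℕ => hermW (n + 1) (2 * √n * s) ^ 2 / ((n + 1).factorial * √n)) atTop
      (𝓝 0) := by
  have hc : 0 < 1 - s ^ 2 := by nlinarith
  have herr : Tendsto (fun n : ℕ => 1 / (1 - s ^ 2) * (1 / (n : ℝ)) *
      (hermEnergy (n + 1) 0 / ((n + 1).factorial * √n))) atTop (𝓝 0) := by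
    have := ((tendsto_one_div_atTop_nhds_zero_nat (𝕜 := ℝ)).const_mul
      (1 / (1 - s ^ 2))).mul tendsto_hermEnergy_zero_succ
    simpa using this
  refine squeeze_zero' (.of_forall fun n => by positivity) ?_ herr
  filter_upwards [eventually_gt_atTop 0] with n hn
  have hn' : (0 : ℝ) < n := by exact_mod_cast hn
  have hX : 0 ≤ 2 * √n * s := by positivity
  have hE := hermEnergy_zero_nonneg (n + 1)
  rw [mul_div_assoc']
  gcongr
  refine (hermW_sq_le hX (potential_scaled_pos n 1 h0 h1)).trans ?_
  rw [potential_scaled, one_div_mul_one_div, div_mul_eq_mul_div, one_mul]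
  gcongr
  rw [mul_comm]
  norm_num

/-- Christoffel–Darboux at `(x, 0)` leaves two products of Hermite values, each bounded by an energy
at `0`. Dividing by `x²`, of order `n`, yields the decay. -/
lemma hermKernelZero_sq_le {n : ℕ} (hn : 0 < n) (h0 : 0 < s) (h1 : s < 1) :
    Real.exp (-(2 * √n * s) ^ 2 / 2) * hermKernelZero (n + 1) (2 * √n * s) ^ 2 ≤
      4 * (hermEnergy (n + 1) 0 / ((n + 1).factorial * √n)) *
        (hermEnergy n 0 / (n.factorial * √n)) / (s ^ 2 * (1 - s ^ 2)) * (1 / (n : ℝ)) := by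
  have hc : 0 < 1 - s ^ 2 := by nlinarith
  have hn' : (0 : ℝ) < n := by exact_mod_cast hn
  have hX : 0 < 2 * √n * s := by positivity
  have hcd := mul_sum_herm_mul_herm_zero n (2 * √n * s)
  have hq1 := hermW_sq_le hX.le (potential_scaled_pos n 1 h0 h1)
  have hq0 := hermW_sq_le hX.le (potential_scaled_pos n 0 h0 h1)
  have hE1 := hermEnergy_zero_nonneg (n + 1)
  have hE0 := hermEnergy_zero_nonneg n
  have b0 : herm n 0 ^ 2 ≤ hermEnergy n 0 / n := by
    rw [le_div_iff₀ hn', hermEnergy_zero]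
    nlinarith [sq_nonneg (n * herm (n - 1) 0), sq_nonneg (herm n 0)]
  have b1 : herm (n + 1) 0 ^ 2 ≤ hermEnergy (n + 1) 0 / n := by
    rw [le_div_iff₀ hn', hermEnergy_zero]
    push_cast
    nlinarith [sq_nonneg ((n + 1) * herm (n + 1 - 1) 0), sq_nonneg (herm (n + 1) 0)]
  have c1 : hermW (n + 1) (2 * √n * s) ^ 2 ≤ hermEnergy (n + 1) 0 / (n * (1 - s ^ 2)) := by
    refine hq1.trans ?_
    rw [potential_scaled]
    gcongr
    norm_num
  have c0 : hermW n (2 * √n * s) ^ 2 ≤ hermEnergy n 0 / (n * (1 - s ^ 2)) := by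
    refine hq0.trans ?_
    rw [potential_scaled]
    exact div_le_div_of_nonneg_left hE0 (by positivity) (by norm_num)
  change (2 * √n * s) * hermKernelZero (n + 1) (2 * √n * s) * n.factorial = _ at hcd
  set x := 2 * √n * s with hx
  have hexp : Real.exp (-x ^ 2 / 2) = Real.exp (-x ^ 2 / 4) ^ 2 := by
    rw [← Real.exp_nat_mul]; congr 1; push_cast; ring
  have hw : x * n.factorial * (Real.exp (-x ^ 2 / 4) * hermKernelZero (n + 1) x) =
      hermW (n + 1) x * herm n 0 - hermW n x * herm (n + 1) 0 := by
    rw [hermW, hermW]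
    linear_combination Real.exp (-x ^ 2 / 4) * hcd
  have m1 := mul_le_mul c1 b0 (sq_nonneg _) (by positivity)
  have m0 := mul_le_mul c0 b1 (sq_nonneg _) (by positivity)
  have hsq : (x * n.factorial) ^ 2 * (Real.exp (-x ^ 2 / 2) * hermKernelZero (n + 1) x ^ 2) ≤
      4 * (hermEnergy (n + 1) 0 * hermEnergy n 0 / (n ^ 2 * (1 - s ^ 2))) := by
    rw [hexp, ← mul_pow, ← mul_pow, hw]
    have e1 : hermEnergy (n + 1) 0 / (n * (1 - s ^ 2)) * (hermEnergy n 0 / n) =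
      hermEnergy (n + 1) 0 * hermEnergy n 0 / (n ^ 2 * (1 - s ^ 2)) := by field_simp
    have e0 : hermEnergy n 0 / (n * (1 - s ^ 2)) * (hermEnergy (n + 1) 0 / n) =
      hermEnergy (n + 1) 0 * hermEnergy n 0 / (n ^ 2 * (1 - s ^ 2)) := by field_simp
    rw [e1] at m1
    rw [e0] at m0
    -- This is `(p - q)² ≤ 2p² + 2q²`.
    nlinarith [sq_nonneg (hermW (n + 1) x * herm n 0 + hermW n x * herm (n + 1) 0)]
  have hx2 : x ^ 2 = 4 * n * s ^ 2 := by
    rw [hx, mul_pow, mul_pow, Real.sq_sqrt hn'.le]; ring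
  have hpos : 0 < (x * n.factorial) ^ 2 := by positivity
  rw [← le_div_iff₀' hpos] at hsq
  refine hsq.trans ?_
  rw [mul_pow, hx2, Nat.factorial_succ]
  -- Compares the factor `4n` of `x²` with the extra `n + 1` of the normalizing `(n + 1)!`.
  have hn1 : (n + 1 : ℝ) ≤ 4 * n := by
    have : (1 : ℝ) ≤ n := by exact_mod_cast hn
    linarith
  have hs2 := Real.mul_self_sqrt hn'.le
  have e : 4 * (hermEnergy (n + 1) 0 / (((n + 1) * n.factorial : ℕ) * √n)) *
        (hermEnergy n 0 / (n.factorial * √n)) / (s ^ 2 * (1 - s ^ 2)) * (1 / (n : ℝ)) =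
      4 * (hermEnergy (n + 1) 0 * hermEnergy n 0 / (n ^ 2 * (1 - s ^ 2))) /
        ((n + 1) * s ^ 2 * n.factorial ^ 2) := by
    rw [show 4 * (hermEnergy (n + 1) 0 / (((n + 1) * n.factorial : ℕ) * √n)) *
        (hermEnergy n 0 / (n.factorial * √n)) / (s ^ 2 * (1 - s ^ 2)) * (1 / (n : ℝ)) =
      4 * (hermEnergy (n + 1) 0 * hermEnergy n 0) / ((n + 1) * n.factorial ^ 2 * (√n * √n) *
        (s ^ 2 * (1 - s ^ 2)) * n) by push_cast; field_simp, hs2]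
    field_simp
  rw [e]
  gcongr

lemma tendsto_hermKernelZero_scaled (h0 : 0 < s) (h1 : s < 1) :
    Tendsto (fun n : ℕ => Real.exp (-(2 * √n * s) ^ 2 / 2) *
      hermKernelZero (n + 1) (2 * √n * s) ^ 2 / hermKernelZero (n + 1) 0 / √n) atTop (𝓝 0) := by
  have herr := (((tendsto_hermEnergy_zero_succ.const_mul 4).mul
    tendsto_hermEnergy_zero).div_const (s ^ 2 * (1 - s ^ 2))).mul
      (tendsto_one_div_atTop_nhds_zero_nat (𝕜 := ℝ))
  rw [mul_zero] at herr
  have hκ : ∀ n : ℕ, 1 ≤ hermKernelZero (n + 1) 0 := one_le_hermKernelZero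
  refine squeeze_zero' (.of_forall fun n => ?_) ?_ herr
  · have := hκ n
    positivity
  · filter_upwards [eventually_gt_atTop 0] with n hn
    have hn' : (1 : ℝ) ≤ √n := Real.one_le_sqrt.2 (by exact_mod_cast hn)
    refine le_trans ?_ (hermKernelZero_sq_le hn h0 h1)
    rw [div_div]
    exact div_le_self (by positivity) (one_le_mul_of_one_le_of_one_le (hκ n) hn')

lemma inv_mul_radialDensity_eq {n : ℕ} (hn : 0 < n) (h0 : 0 < s) :
    1 / (2 * √n) * radialDensity n (2 * √n * s) = 1 / √(2 * Real.pi) *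
      (hermEnergy (n + 1) (2 * √n * s) / ((n + 1).factorial * √n) -
        1 / 2 * (hermW (n + 1) (2 * √n * s) ^ 2 / ((n + 1).factorial * √n)) -
        Real.exp (-(2 * √n * s) ^ 2 / 2) * hermKernelZero (n + 1) (2 * √n * s) ^ 2 /
          hermKernelZero (n + 1) 0 / √n) := by
  have hn' : (0 : ℝ) < n := by exact_mod_cast hn
  rw [radialDensity_eq n (by positivity), sum_herm_sq_mul_exp]
  have : 0 < √(2 * Real.pi) := by positivity
  have := one_le_hermKernelZero n
  field_simp

lemma one_div_sqrt_mul_sqrt (a : ℝ) :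
    1 / √(2 * Real.pi) * (√(2 / Real.pi) * a) = 1 / Real.pi * a := by
  rw [← mul_assoc, Real.sqrt_mul zero_le_two, Real.sqrt_div zero_le_two]
  have h := Real.mul_self_sqrt Real.pi_pos.le
  have h2 : (0 : ℝ) < √2 := by positivity
  have h3 : 0 < √Real.pi := Real.sqrt_pos.2 Real.pi_pos
  rw [show 1 / (√2 * √Real.pi) * (√2 / √Real.pi) = 1 / (√Real.pi * √Real.pi) by field_simp, h]

theorem tendsto_radialDensity_of_lt_one (h0 : 0 < s) (h1 : s < 1) :
    Tendsto (fun n : ℕ => 1 / (2 * √(n : ℝ)) * radialDensity n (2 * √(n : ℝ) * s)) atTop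
      (𝓝 (1 / Real.pi * √(1 - s ^ 2))) := by
  have h := (((tendsto_hermEnergy_scaled h0 h1).sub
    ((tendsto_hermW_scaled h0 h1).const_mul (1 / 2))).sub
      (tendsto_hermKernelZero_scaled h0 h1)).const_mul (1 / √(2 * Real.pi))
  rw [mul_zero, sub_zero, sub_zero, one_div_sqrt_mul_sqrt] at h
  refine h.congr' ?_
  filter_upwards [eventually_gt_atTop 0] with n hn using (inv_mul_radialDensity_eq hn h0).symm

theorem tendsto_radialDensity_of_one_lt (hs : 1 < s) :
    Tendsto (fun n : ℕ => 1 / (2 * √(n : ℝ)) * radialDensity n (2 * √(n : ℝ) * s)) atTop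
      (𝓝 0) := by
  have hcont : Tendsto (fun t : ℝ => 1 / Real.pi * √(1 - t ^ 2)) (𝓝[<] 1) (𝓝 0) := by
    have : Continuous fun t : ℝ => 1 / Real.pi * √(1 - t ^ 2) := by fun_prop
    have h := (this.tendsto 1).mono_left (nhdsWithin_le_nhds (s := Set.Iio 1))
    simpa using h
  rw [tendsto_order]
  constructor
  · intro a ha
    exact .of_forall fun n => ha.trans_le (mul_nonneg (by positivity) (radialDensity_nonneg _ _))
  · intro ε hε
    -- Some `t < 1` has semicircle value below `ε`; as `t < s`, the antitone energy carries this
    -- bound past the edge, and the subtracted terms are nonnegative.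
    obtain ⟨t, ht, ht0, ht1⟩ := ((hcont.eventually_lt_const hε).and
      (Ioo_mem_nhdsLT (zero_lt_one (α := ℝ)))).exists
    have h := (tendsto_hermEnergy_scaled ht0 ht1).const_mul (1 / √(2 * Real.pi))
    rw [one_div_sqrt_mul_sqrt] at h
    filter_upwards [h.eventually_lt_const ht, eventually_gt_atTop 0] with n hlt hn
    refine lt_of_le_of_lt ?_ hlt
    rw [inv_mul_radialDensity_eq hn (by linarith)]
    refine mul_le_mul_of_nonneg_left ?_ (by positivity)
    have hκ := one_le_hermKernelZero n
    have e1 : 0 ≤ 1 / 2 * (hermW (n + 1) (2 * √n * s) ^ 2 / ((n + 1).factorial * √n)) := by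
      positivity
    have e2 : 0 ≤ Real.exp (-(2 * √n * s) ^ 2 / 2) * hermKernelZero (n + 1) (2 * √n * s) ^ 2 /
        hermKernelZero (n + 1) 0 / √n := by positivity
    have e3 : hermEnergy (n + 1) (2 * √n * s) / ((n + 1).factorial * √n) ≤
        hermEnergy (n + 1) (2 * √n * t) / ((n + 1).factorial * √n) := by
      refine div_le_div_of_nonneg_right (hermEnergy_antitoneOn _ ?_ ?_ ?_) (by positivity)
      · exact Set.mem_Ici.2 (mul_nonneg (by positivity) ht0.le)
      · exact Set.mem_Ici.2 (mul_nonneg (by positivity) (by linarith))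
      · exact mul_le_mul_of_nonneg_left (by linarith) (by positivity)
    linarith

end

end QuaternionField
end

theorem mainTheorem8 :
    (∀ n : ℕ, Continuous (QuaternionField.fieldDensity n) ∧
      ∀ (Ω : Type*) [MeasurableSpace Ω] (ℙ : Measure Ω) [IsProbabilityMeasure ℙ]
        (X : Ω → Measure QuaternionField.Space),
        QuaternionField.IsDeterminantalField ℙ X QuaternionField.background
          (QuaternionField.kernel n) →
        QuaternionField.IsFieldDensity ℙ X (QuaternionField.fieldDensity n)) ∧
    ∀ s : ℝ, 0 < s →
      (s < 1 →
        Tendsto (fun n : ℕ => 1 / (2 * √(n : ℝ)) *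
            QuaternionField.radialDensity n (2 * √(n : ℝ) * s)) atTop
          (𝓝 (1 / Real.pi * √(1 - s ^ 2)))) ∧
      (1 < s →
        Tendsto (fun n : ℕ => 1 / (2 * √(n : ℝ)) *
            QuaternionField.radialDensity n (2 * √(n : ℝ) * s)) atTop (𝓝 0)) := by
  refine ⟨fun n => ⟨QuaternionField.continuous_fieldDensity n, fun Ω _ ℙ _ X hX =>
    QuaternionField.isFieldDensity_fieldDensity n ℙ X hX⟩, fun s hs => ⟨fun h =>
    QuaternionField.tendsto_radialDensity_of_lt_one hs h, fun h =>
    QuaternionField.tendsto_radialDensity_of_one_lt h⟩⟩
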